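/- \textbf{Definitions.} A \emph{tree order} is a partial order with a minimum element in which, for every $x$, the set $\{y : y\le x\}$ is linearly ordered; a \emph{branch} is a maximal chain. A \emph{branchwise-real tree} is a tree order in which every branch is order-isomorphic to an interval of $\mathbb R$ and any two elements $x,y$ have a meet (the set $\{z : z\le x,\ z\le y\}$ has a maximum). The \emph{degree} of a point $x$ is the number of equivalence classes of $\{y : y>x\}$ under the relation: $y\sim_x z$ iff there is $w>x$ with $w\le y$ and $w\le z$. A tree order is \emph{uniformly $\kappa$-branching} if every point has degree $\kappa$, and \emph{rigid} if its only order-automorphism is the identity. An \emph{$\mathbb R$-grading} of a partial order $X$ is a function $\ell:X\to\mathbb R$ such that $x<y$ implies $\ell(x)<\ell(y)$; it is \emph{continuous} if for all $x<y$ it restricts to an order-isomorphism from $[x,y]$ onto $[\ell(x),\ell(y)]$. $X$ is \emph{$\mathbb R$-gradable} (\emph{continuously gradable}) if it has an $\mathbb R$-grading (a continuous one). A tree order is \emph{well-stratified} if every branch is order-isomorphic to an ordinal. Let $T$ be the set of all functions $r$ from a countable ordinal to $\omega$ such that $r$ is injective with values in $\omega\setminus\{0\}$ on the successor ordinals in its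 domain and is $0$ at all other points of its domain, ordered by function extension. \textbf{Theorem.} The tree $T$ is well-stratified and not $\mathbb R$-gradable. For every cardinal $\kappa$ with $2\le\kappa\le\mathfrak c^+$ there is a branchwise-real tree $X$ which is uniformly $\kappa$-branching, rigid and not continuously gradable; moreover $X$ is not $\mathbb R$-gradable (there is no function $\ell:X\to\mathbb R$ such that $x<y$ implies $\ell(x)<\ell(y)$), and $X$ contains a copy of $T$ (there is an order embedding $T\to X$). -/

import Mathlib

universe u

/-- A tree order: every `{y | y ≤ x}` is linearly ordered, and there is a minimum element. -/
class IsTreeOrder (X : Type u) [PartialOrder X] : Prop where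
  isChain_Iic : ∀ x : X, IsChain (· ≤ ·) (Set.Iic x)
  exists_root : ∃ r : X, ∀ x : X, r ≤ x

/-- A branch is a maximal chain. -/
def IsBranch {X : Type u} [PartialOrder X] (B : Set X) : Prop :=
  IsMaxChain (· ≤ ·) B

/-- A branchwise-real tree: a tree order in which every branch is order-isomorphic to an interval
(an order-convex subset) of the real line, and in which any two elements have a meet. -/
class IsBranchwiseReal (X : Type u) [PartialOrder X] : Prop extends IsTreeOrder X where
  branch_iso : ∀ B : Set X, IsBranch B → ∃ I : Set ℝ, I.OrdConnected ∧ Nonempty (B ≃o I)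
  exists_meet : ∀ x y : X, ∃ m : X, IsGreatest {z : X | z ≤ x ∧ z ≤ y} m

/-- A well-stratified tree: a tree order in which every branch is order-isomorphic to an ordinal. -/
class IsWellStratified (X : Type u) [PartialOrder X] : Prop extends IsTreeOrder X where
  branch_iso : ∀ B : Set X, IsBranch B → ∃ o : Ordinal.{u}, Nonempty (B ≃o Set.Iio o)

/-- The relation `y ∼ₓ z` on the points strictly above `x`:
there is `w > x` with `w ≤ y` and `w ≤ z`. -/
def componentSetoid {X : Type u} [PartialOrder X] [IsTreeOrder X] (x : X) :
    Setoid (Set.Ioi x) where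
  r y z := ∃ w : X, x < w ∧ w ≤ (y : X) ∧ w ≤ (z : X)
  iseqv :=
    { refl := fun y => ⟨y, y.2, le_rfl, le_rfl⟩
      symm := fun ⟨w, h, hy, hz⟩ => ⟨w, h, hz, hy⟩
      trans := by
        rintro a b c ⟨w, hw, hwa, hwb⟩ ⟨w', hw', hwb', hwc'⟩
        rcases (IsTreeOrder.isChain_Iic (b : X)).total hwb hwb' with h | h
        · exact ⟨w, hw, hwa, h.trans hwc'⟩
        · exact ⟨w', hw', h.trans hwa, hwc'⟩ }

/-- The degree of `x`: the number of connected components above `x`. -/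
noncomputable def treeDegree {X : Type u} [PartialOrder X] [IsTreeOrder X] (x : X) :
    Cardinal.{u} :=
  Cardinal.mk (Quotient (componentSetoid x))

/-- Every node has degree `κ`. -/
def IsUniformlyBranching (κ : Cardinal.{u}) (X : Type u) [PartialOrder X] [IsTreeOrder X] : Prop :=
  ∀ x : X, treeDegree x = κ

/-- The only order-automorphism is the identity. -/
def IsOrderRigid (X : Type u) [PartialOrder X] : Prop :=
  ∀ f : X ≃o X, f = OrderIso.refl X

/-- There is an `ℝ`-grading: a function into `ℝ` with `x < y → ℓ x < ℓ y`. -/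
def IsRealGradable (X : Type u) [PartialOrder X] : Prop :=
  ∃ l : X → ℝ, StrictMono l

/-- A continuous grading: an `ℝ`-grading whose restriction to every `[x, y]`, `x < y`, is an
order-isomorphism onto `[ℓ x, ℓ y]`. -/
def IsContinuousGrading {X : Type u} [PartialOrder X] (l : X → ℝ) : Prop :=
  StrictMono l ∧ ∀ x y : X, x < y →
    ∃ e : Set.Icc x y ≃o Set.Icc (l x) (l y), ∀ z : Set.Icc x y, (e z : ℝ) = l (z : X)

/-- `X` admits a continuous grading. -/
def IsContinuouslyGradable (X : Type u) [PartialOrder X] : Prop :=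
  ∃ l : X → ℝ, IsContinuousGrading l

/-- `r`, viewed as a partial function from ordinals to `ℕ`, has a countable ordinal as its domain,
is injective with nonzero values on the successor ordinals of its domain, and vanishes on the other
ordinals of its domain. -/
def IsShiftedInjection (r : Ordinal.{0} → Part ℕ) : Prop :=
  (∃ a : Ordinal.{0}, a < Ordinal.omega 1 ∧ ∀ b, (r b).Dom ↔ b < a) ∧
  (∀ b ∈ Set.range (Order.succ : Ordinal.{0} → Ordinal.{0}),
    ∀ c ∈ Set.range (Order.succ : Ordinal.{0} → Ordinal.{0}),
      ∀ n : ℕ, n ∈ r b → n ∈ r c → b = c) ∧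
  (∀ b ∈ Set.range (Order.succ : Ordinal.{0} → Ordinal.{0}), ∀ n : ℕ, n ∈ r b → n ≠ 0) ∧
  (∀ b ∉ Set.range (Order.succ : Ordinal.{0} → Ordinal.{0}), ∀ n : ℕ, n ∈ r b → n = 0)

/-- The Baumgartner–Galvin–Laver tree. The order, inherited pointwise from `Part ℕ`, is extension
of partial functions. -/
def BGLTree : Type 1 := {r : Ordinal.{0} → Part ℕ // IsShiftedInjection r}

instance : PartialOrder BGLTree :=
  inferInstanceAs (PartialOrder {r : Ordinal.{0} → Part ℕ // IsShiftedInjection r})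

/-- The order on `BGLTree` is extension of partial functions. -/
theorem BGLTree.le_iff (r s : BGLTree) :
    r ≤ s ↔ ∀ (b : Ordinal.{0}) (n : ℕ), n ∈ r.1 b → n ∈ s.1 b :=
  Iff.rfl

/-! A node of the ray tree runs along rays `[0, ∞)` indexed by an initial segment of ω₁, recording
the coordinate and the nonzero side in `K` at which each earlier ray is left. Staying on the last
ray counts as direction `0 : K`, so every node has `#K` directions. Each ray is coloured by ℕ, and a
node may leave rays at points of a given colour only finitely often.

Finiteness makes the set of ray indices along a chain countable, so on a branch the nodes with
rational last coordinate form a countable order-dense set; as bounded sets have suprema, the branch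
is a real interval. Yet an increasing sequence whose exits use each colour finitely often is still
bounded.

Rigidity plays these two facts against each other. A nontrivial automorphism `f` makes some `x`
incomparable with `f x`, so `f` carries segments above `x` to segments of different rays. The
colouring is generic: any isomorphism between open intervals of distinct rays matches some point of
prescribed colour `n` with a point of colour `0`. Climbing from `x`, one gets nodes of distinct
positive colours whose images have colour `0`, with exits on both sides. The nodes have an upper
bound `p`, but `f p` leaves infinitely many rays at colour `0`.

The colouring comes from a recursion of length continuum and serves rays indexed by sets of reals;
for `κ ≤ 𝔠⁺ ≤ 2^𝔠` there are at most `2^𝔠` rays.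

The tree `T` embeds by leaving the rays at points whose colours are the successor values of a
function. Since `T` is not gradable, neither is the ray tree. For `T` itself, extend a sequence
towards suprema of a bounded grading while reserving more and more unused values; its limit and a
one-step extension of the limit would get equal grades. -/

open Set

/-! ### Nodes of the ray tree and their order. -/

section RayTree

variable {W : Type} [LinearOrder W] {K : Type u} [Zero K]

/-- The label at index `β` of a path `e`: the colour of the exit coordinate on the ray determined by
the restriction of `e` to indices below `β`. -/
noncomputable def pathLabel (col : W × (W → ℝ × K) → ℝ → ℕ) (e : W → ℝ × K) (β : W) : ℕ :=
  col (β, (Iio β).indicator e) (e β).1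

theorem pathLabel_congr (col : W × (W → ℝ × K) → ℝ → ℕ) {e e' : W → ℝ × K} {β : W}
    (h : ∀ γ ≤ β, e γ = e' γ) : pathLabel col e β = pathLabel col e' β := by
  have h1 : (Iio β).indicator e = (Iio β).indicator e' := by
    funext γ
    by_cases hγ : γ < β
    · simp [hγ, h γ hγ.le]
    · simp [hγ]
  simp [pathLabel, h1, h β le_rfl]

/-- The path following `e` below `δ` and ending at coordinate `t` of the ray with index `δ`. -/
def gluePath (e : W → ℝ × K) (δ : W) (t : ℝ) : W → ℝ × K :=
  fun β => if β < δ then e β else if β = δ then (t, 0) else 0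

theorem gluePath_of_lt (e : W → ℝ × K) {δ β : W} (t : ℝ) (h : β < δ) :
    gluePath e δ t β = e β := if_pos h

@[simp] theorem gluePath_self (e : W → ℝ × K) (δ : W) (t : ℝ) : gluePath e δ t δ = (t, 0) := by
  simp [gluePath]

theorem gluePath_of_gt (e : W → ℝ × K) {δ β : W} (t : ℝ) (h : δ < β) :
    gluePath e δ t β = 0 := by
  simp [gluePath, h.not_gt, h.ne']

variable [SuccOrder W]

/-- A node of the ray tree: a sequence of rays indexed by `Set.Iic len`, together with the
coordinate and the side at which each ray is left; the last ray is not left (side `0`).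
Rays of successor index are open at their starting point, and every label occurs finitely often. -/
structure RayNode (col : W × (W → ℝ × K) → ℝ → ℕ) where
  len : W
  path : W → ℝ × K
  side_ne : ∀ β < len, (path β).2 ≠ 0
  side_len : (path len).2 = 0
  path_above : ∀ β, len < β → path β = 0
  coord_nonneg : ∀ β, 0 ≤ (path β).1
  coord_pos : ∀ β < len, 0 < (path (Order.succ β)).1
  finite_label : ∀ n, {β | β < len ∧ pathLabel col path β = n}.Finite

namespace RayNode

variable {col : W × (W → ℝ × K) → ℝ → ℕ}

/-- The coordinate of a node on its last ray. -/
def pos (x : RayNode col) : ℝ := (x.path x.len).1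

theorem path_len (x : RayNode col) : x.path x.len = (x.pos, 0) :=
  Prod.ext rfl x.side_len

theorem pos_nonneg (x : RayNode col) : 0 ≤ x.pos := x.coord_nonneg _

/-- The node with path `gluePath e δ t`. -/
def glue (e : W → ℝ × K) (δ : W) (t : ℝ) (hside : ∀ β < δ, (e β).2 ≠ 0)
    (hnonneg : ∀ β < δ, 0 ≤ (e β).1) (ht : 0 ≤ t)
    (hpos : ∀ β < δ, Order.succ β < δ → 0 < (e (Order.succ β)).1)
    (htpos : ∀ β < δ, Order.succ β = δ → 0 < t)
    (hfin : ∀ n, {β | β < δ ∧ pathLabel col e β = n}.Finite) : RayNode col where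
  len := δ
  path := gluePath e δ t
  side_ne β hβ := by rw [gluePath_of_lt e t hβ]; exact hside β hβ
  side_len := by simp
  path_above β hβ := gluePath_of_gt e t hβ
  coord_nonneg β := by
    rcases lt_trichotomy β δ with h | rfl | h
    · rw [gluePath_of_lt e t h]; exact hnonneg β h
    · simpa
    · rw [gluePath_of_gt e t h]; exact le_rfl
  coord_pos β hβ := by
    rcases (Order.succ_le_of_lt hβ).lt_or_eq with h | h
    · rw [gluePath_of_lt e t h]; exact hpos β hβ h
    · rw [h]; simpa using htpos β hβ h
  finite_label n := by
    refine (hfin n).subset fun β hβ => ⟨hβ.1, ?_⟩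
    rw [← hβ.2]
    exact pathLabel_congr col fun γ hγ => (gluePath_of_lt e t (hγ.trans_lt hβ.1)).symm

theorem ext_of {x y : RayNode col} (hlen : x.len = y.len) (hpath : ∀ β < x.len, x.path β = y.path β)
    (hpos : x.pos = y.pos) : x = y := by
  have h : x.path = y.path := by
    funext β
    rcases lt_trichotomy β x.len with h | rfl | h
    · exact hpath β h
    · rw [path_len, hpos, hlen, path_len]
    · rw [x.path_above β h, y.path_above β (hlen ▸ h)]
  cases x; cases y; cases hlen; cases h; rfl

/-- If `x.len < y.len`, the last condition compares `x` with the point where `y` leaves that ray; if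
the lengths agree, it compares the final coordinates. The side plays no role there, so a node lies
below every path leaving at it. -/
instance : PartialOrder (RayNode col) where
  le x y := x.len ≤ y.len ∧ (∀ β < x.len, x.path β = y.path β) ∧ x.pos ≤ (y.path x.len).1
  le_refl x := ⟨le_rfl, fun _ _ => rfl, le_rfl⟩
  le_trans x y z := by
    rintro ⟨h1, h2, h3⟩ ⟨k1, k2, k3⟩
    refine ⟨h1.trans k1, fun β hβ => (h2 β hβ).trans (k2 β (hβ.trans_le h1)), ?_⟩
    rcases h1.lt_or_eq with h | h
    · rwa [← k2 _ h]
    · rw [h] at h3 ⊢; exact h3.trans k3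
  le_antisymm x y := by
    rintro ⟨h1, h2, h3⟩ ⟨k1, k2, k3⟩
    have h := le_antisymm h1 k1
    refine ext_of h h2 (le_antisymm ?_ ?_)
    · rwa [h] at h3
    · rwa [← h] at k3

theorem len_le {x y : RayNode col} (h : x ≤ y) : x.len ≤ y.len := h.1

theorem path_eq {x y : RayNode col} (h : x ≤ y) {β : W} (hβ : β < x.len) :
    x.path β = y.path β := h.2.1 β hβ

theorem pos_le {x y : RayNode col} (h : x ≤ y) : x.pos ≤ (y.path x.len).1 := h.2.2

theorem pos_le_pos {x y : RayNode col} (h : x ≤ y) (hl : x.len = y.len) : x.pos ≤ y.pos := by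
  have := pos_le h
  rwa [hl] at this

theorem coord_le {x y : RayNode col} (h : x ≤ y) {β : W} (hβ : β ≤ x.len) :
    (x.path β).1 ≤ (y.path β).1 := by
  rcases hβ.lt_or_eq with hβ | rfl
  · rw [path_eq h hβ]
  · exact pos_le h

theorem label_eq {x y : RayNode col} (h : x ≤ y) {β : W} (hβ : β < x.len) :
    pathLabel col x.path β = pathLabel col y.path β :=
  pathLabel_congr col fun _ hγ => path_eq h (hγ.trans_lt hβ)

theorem le_total_of_le {x y z : RayNode col} (hy : y ≤ x) (hz : z ≤ x) : y ≤ z ∨ z ≤ y := by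
  wlog h : y.len ≤ z.len generalizing y z
  · exact (this hz hy (le_of_not_ge h)).symm
  have hp : ∀ β < y.len, y.path β = z.path β := fun β hβ => by
    rw [path_eq hy hβ, path_eq hz (hβ.trans_le h)]
  rcases h.lt_or_eq with h' | h'
  · exact Or.inl ⟨h, hp, by rw [path_eq hz h']; exact pos_le hy⟩
  · rcases le_total y.pos z.pos with k | k
    · exact Or.inl ⟨h, hp, by rw [h']; exact k⟩
    · exact Or.inr ⟨h'.ge, fun β hβ => (hp β (hβ.trans_eq h'.symm)).symm, by rw [← h']; exact k⟩

/-- The node below `x` with coordinate `t` on the ray with index `δ`. -/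
def cut (x : RayNode col) (δ : W) (t : ℝ) (hδ : δ ≤ x.len) (ht : 0 ≤ t)
    (htpos : ∀ β < δ, Order.succ β = δ → 0 < t) : RayNode col :=
  glue x.path δ t (fun β hβ => x.side_ne β (hβ.trans_le hδ)) (fun β _ => x.coord_nonneg β) ht
    (fun β hβ _ => x.coord_pos β (hβ.trans_le hδ)) htpos
    (fun n => (x.finite_label n).subset fun _ hβ => ⟨hβ.1.trans_le hδ, hβ.2⟩)

section glue

variable {e : W → ℝ × K} {δ : W} {t : ℝ} {h1 h2 h3 h4 h5 h6}

@[simp] theorem glue_len : (glue (col := col) e δ t h1 h2 h3 h4 h5 h6).len = δ := rfl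

@[simp] theorem glue_pos : (glue (col := col) e δ t h1 h2 h3 h4 h5 h6).pos = t := by
  simp [pos, glue]

theorem glue_path {β : W} (hβ : β < δ) :
    (glue (col := col) e δ t h1 h2 h3 h4 h5 h6).path β = e β := gluePath_of_lt e t hβ

end glue

section cut

variable {x : RayNode col} {δ : W} {t : ℝ} {h1 h2 h3}

@[simp] theorem cut_len : (x.cut δ t h1 h2 h3).len = δ := rfl

@[simp] theorem cut_pos : (x.cut δ t h1 h2 h3).pos = t := glue_pos

theorem cut_path {β : W} (hβ : β < δ) : (x.cut δ t h1 h2 h3).path β = x.path β := glue_path hβ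

theorem cut_le (ht : t ≤ (x.path δ).1) : x.cut δ t h1 h2 h3 ≤ x :=
  ⟨h1, fun _ hβ => cut_path hβ, by simpa⟩

theorem le_cut_of_lt {y : RayNode col} (hy : y ≤ x) (hl : y.len < δ) : y ≤ x.cut δ t h1 h2 h3 :=
  ⟨hl.le, fun β hβ => by rw [cut_path (hβ.trans hl), path_eq hy hβ],
    by rw [cut_path hl]; exact pos_le hy⟩

theorem le_cut_of_eq {y : RayNode col} (hy : y ≤ x) (hl : y.len = δ) (ht : y.pos ≤ t) :
    y ≤ x.cut δ t h1 h2 h3 := by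
  subst hl
  refine ⟨le_rfl, fun β hβ => by rw [cut_path hβ, path_eq hy hβ], ?_⟩
  change y.pos ≤ (x.cut y.len t h1 h2 h3).pos
  simpa

end cut

theorem pos_pos_of_succ {y : RayNode col} {β : W} (hβ : β < y.len) (hs : Order.succ β = y.len) :
    0 < y.pos := by
  have := y.coord_pos β hβ; rwa [hs] at this

end RayNode
end RayTree

/-! ### Recognising real intervals, and a countability criterion. -/

/-- A linear order which has a countable order-dense subset and in which every nonempty bounded set
has a least upper bound is isomorphic to an interval of the real line. -/
theorem exists_orderIso_ordConnected {L : Type u} [LinearOrder L] (D : Set L) (hD : D.Countable)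
    (hdense : ∀ x y : L, x < y → ∃ d ∈ D, x < d ∧ d < y)
    (hlub : ∀ C : Set L, C.Nonempty → BddAbove C → ∃ z, IsLUB C z) :
    ∃ I : Set ℝ, I.OrdConnected ∧ Nonempty (L ≃o I) := by
  suffices h : ∃ F : L → ℝ, StrictMono F ∧ (range F).OrdConnected by
    obtain ⟨F, hF, hI⟩ := h
    exact ⟨range F, hI, ⟨hF.orderIso F⟩⟩
  rcases subsingleton_or_nontrivial L with hL | hL
  · refine ⟨fun _ => 0, fun x y h => absurd (Subsingleton.elim x y) h.ne, ?_⟩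
    refine ⟨?_⟩
    rintro _ ⟨x, rfl⟩ _ ⟨_, rfl⟩ r hr
    exact ⟨x, le_antisymm hr.1 hr.2⟩
  -- Discarding endpoints makes Cantor's theorem on countable dense orders applicable.
  let E : Set L := {d | d ∈ D ∧ (∃ a, a < d) ∧ ∃ b, d < b}
  have hE : ∀ x y : L, x < y → ∃ d : E, x < d ∧ (d : L) < y := fun x y h => by
    obtain ⟨d, hd, h1, h2⟩ := hdense x y h
    exact ⟨⟨d, hd, ⟨x, h1⟩, ⟨y, h2⟩⟩, h1, h2⟩
  have : Countable E := (hD.mono fun _ h => h.1).to_subtype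
  have : DenselyOrdered E := ⟨fun a b h => hE a b h⟩
  have : NoMinOrder E := ⟨fun a => by
    obtain ⟨b, hb⟩ := a.2.2.1
    obtain ⟨d, -, h⟩ := hE b a hb
    exact ⟨d, h⟩⟩
  have : NoMaxOrder E := ⟨fun a => by
    obtain ⟨b, hb⟩ := a.2.2.2
    obtain ⟨d, h, -⟩ := hE a b hb
    exact ⟨d, h⟩⟩
  have : Nonempty E := by
    obtain ⟨x, y, h⟩ := exists_pair_lt L
    exact ⟨(hE x y h).choose⟩
  have : Nonempty (Ioo (0 : ℚ) 1) := ⟨⟨1 / 2, by norm_num, by norm_num⟩⟩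
  obtain ⟨φ⟩ := Order.iso_of_countable_dense E (Ioo (0 : ℚ) 1)
  let v : E → ℝ := fun d => ((φ d : ℚ) : ℝ)
  have hv : StrictMono v := fun a b h => by
    have : (φ a : ℚ) < φ b := φ.strictMono h
    exact Rat.cast_lt.2 this
  have hv0 : ∀ d, 0 < v d := fun d => Rat.cast_pos.2 (φ d).2.1
  have hv1 : ∀ d, v d ≤ 1 := fun d => by
    have := (Rat.cast_le (K := ℝ)).2 (φ d).2.2.le
    rwa [Rat.cast_one] at this
  -- Inserting `0` keeps the set nonempty when `x` is the least element.
  let S : L → Set ℝ := fun x => insert 0 (v '' {d | (d : L) < x})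
  have hS : ∀ x, BddAbove (S x) := fun x => ⟨1, by
    rintro _ (rfl | ⟨d, -, rfl⟩)
    · exact zero_le_one
    · exact hv1 d⟩
  let F : L → ℝ := fun x => sSup (S x)
  have hF0 : ∀ x, 0 ≤ F x := fun x => le_csSup (hS x) (mem_insert _ _)
  have hF1 : ∀ x, F x ≤ 1 := fun x => csSup_le (insert_nonempty _ _) <| by
    rintro _ (rfl | ⟨d, -, rfl⟩)
    · exact zero_le_one
    · exact hv1 d
  have hlow : ∀ (x : L) (d : E), (d : L) < x → v d ≤ F x := fun x d h =>
    le_csSup (hS x) (mem_insert_of_mem _ ⟨d, h, rfl⟩)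
  have hup : ∀ (x : L) (d : E), x ≤ d → F x ≤ v d := fun x d h =>
    csSup_le (insert_nonempty _ _) <| by
      rintro _ (rfl | ⟨d', h', rfl⟩)
      · exact (hv0 d).le
      · exact hv.monotone (show d' ≤ d from (lt_of_lt_of_le h' h).le)
  have hF : StrictMono F := fun x y h => by
    obtain ⟨d, h1, h2⟩ := hE x y h
    obtain ⟨d', h3, h4⟩ := hE d y h2
    calc F x ≤ v d := hup x d h1.le
      _ < v d' := hv h3
      _ ≤ F y := hlow y d' h4
  refine ⟨F, hF, ⟨?_⟩⟩
  rintro _ ⟨x, rfl⟩ _ ⟨y, rfl⟩ r ⟨hx, hy⟩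
  rcases hx.eq_or_lt with rfl | hx
  · exact ⟨x, rfl⟩
  rcases hy.eq_or_lt with rfl | hy
  · exact ⟨y, rfl⟩
  have hC : BddAbove (insert x ((↑) '' {d : E | v d < r}) : Set L) := ⟨y, by
    rintro _ (rfl | ⟨d, hd, rfl⟩)
    · exact (hF.lt_iff_lt.1 (hx.trans hy)).le
    · by_contra! h
      exact (hd.trans hy).not_ge (hup y d h.le)⟩
  obtain ⟨z, hz⟩ := hlub _ (insert_nonempty _ _) hC
  refine ⟨z, le_antisymm ?_ ?_⟩
  · refine csSup_le (insert_nonempty _ _) ?_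
    rintro _ (rfl | ⟨d, hd, rfl⟩)
    · exact (hF0 x).trans hx.le
    · obtain ⟨c, hc, hdc⟩ := (lt_isLUB_iff hz).1 hd
      rcases hc with rfl | ⟨d', hd', rfl⟩
      · exact (hlow _ _ hdc).trans hx.le
      · exact ((hv hdc).trans hd').le
  -- Two rationals `q < q'` in the gap `(F z, r)` pull back to points of `E`; that of `q'` is at
  -- most `z`, so that of `q` is below `z` and forces `q ≤ F z`.
  · by_contra! h
    obtain ⟨q, hq1, hq2⟩ := exists_rat_btwn h
    obtain ⟨q', hq3, hq4⟩ := exists_rat_btwn hq2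
    have hmem : ∀ p : ℚ, F z < p → (p : ℝ) < r → p ∈ Ioo (0 : ℚ) 1 := fun p h1 h2 =>
      ⟨by exact_mod_cast (hF0 z).trans_lt h1, by exact_mod_cast (h2.trans hy).trans_le (hF1 y)⟩
    have hq := hmem q hq1 hq2
    have hq' := hmem q' (hq1.trans hq3) hq4
    have hvq : v (φ.symm ⟨q, hq⟩) = q := by simp [v]
    have hvq' : v (φ.symm ⟨q', hq'⟩) = q' := by simp [v]
    have h1 : φ.symm ⟨q, hq⟩ < φ.symm ⟨q', hq'⟩ := by
      rw [← hv.lt_iff_lt, hvq, hvq']; exact hq3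
    have h2 : (φ.symm ⟨q', hq'⟩ : L) ≤ z :=
      hz.1 (mem_insert_of_mem _ ⟨_, by rw [mem_ofPred_eq, hvq']; exact hq4, rfl⟩)
    have h3 := hlow z _ (lt_of_lt_of_le h1 h2)
    rw [hvq] at h3
    exact hq1.not_ge h3

/-- Counting predecessors in `S` is a strictly increasing map to ℕ. -/
theorem Set.countable_of_finite_inter_Iio {W : Type*} [LinearOrder W] {S : Set W}
    (h : ∀ w ∈ S, (S ∩ Iio w).Finite) : S.Countable := by
  have hf : StrictMono fun w : S => (S ∩ Iio (w : W)).ncard := fun a b hab => by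
    refine ncard_lt_ncard ⟨fun c hc => ⟨hc.1, lt_trans hc.2 hab⟩, fun hsub => ?_⟩ (h b b.2)
    exact lt_irrefl (a : W) (hsub ⟨a.2, hab⟩).2
  exact hf.injective.countable

/-! ### Meets, suprema and branches of the ray tree. -/

namespace RayNode

variable {W : Type} [LinearOrder W] {K : Type u} [Zero K] [SuccOrder W]
  {col : W × (W → ℝ × K) → ℝ → ℕ}

theorem isChain_Iic (x : RayNode col) : IsChain (· ≤ ·) (Iic x) :=
  fun _ hy _ hz _ => le_total_of_le hy hz

theorem cut_le_of_le {x y : RayNode col} {δ : W} {t : ℝ} {h1 h2 h3} (hy : y ≤ x) (hδ : δ ≤ y.len)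
    (ht : t ≤ (y.path δ).1) : x.cut δ t h1 h2 h3 ≤ y :=
  ⟨hδ, fun β hβ => by
    rw [cut_path (show β < δ from hβ), path_eq hy (lt_of_lt_of_le hβ hδ)], by simpa⟩

theorem eq_of_le_of_len_eq {x y z : RayNode col} (hy : y ≤ x) (hz : z ≤ x) (hl : y.len = z.len)
    (hp : y.pos = z.pos) : y = z :=
  ext_of hl (fun β hβ => by rw [path_eq hy hβ, path_eq hz (hl ▸ hβ)]) hp

theorem coord_pos_of_succ_eq (x : RayNode col) {δ : W} (hδ : δ ≤ x.len) :
    ∀ β < δ, Order.succ β = δ → 0 < (x.path δ).1 := by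
  rintro β hβ rfl
  exact x.coord_pos β (hβ.trans_le hδ)

theorem exists_root [OrderBot W] : ∃ r : RayNode col, ∀ x : RayNode col, r ≤ x :=
  ⟨glue 0 ⊥ 0 (by simp) (by simp) le_rfl (by simp) (by simp) (by simp),
    fun x => ⟨bot_le, by simp, by simpa using x.coord_nonneg _⟩⟩

instance [OrderBot W] : IsTreeOrder (RayNode col) := ⟨isChain_Iic, exists_root⟩

theorem lt_of_le_of_pos_lt {x y : RayNode col} (h : x ≤ y) (hp : x.len < y.len ∨ x.pos < y.pos) :
    x < y := by
  refine lt_of_le_of_ne h ?_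
  rintro rfl
  rcases hp with hp | hp <;> exact lt_irrefl _ hp

/-- If `y` passes beyond `x` on the ray of `x`, there is room on that ray. Otherwise `y` leaves
exactly at `x`, and the room is on the successor ray, where the coordinate of `y` is positive. -/
theorem exists_rat_pos_between [NoMaxOrder W] {x y : RayNode col} (hxy : x < y) :
    ∃ z, x < z ∧ z < y ∧ ∃ q : ℚ, z.pos = q := by
  have hle := hxy.le
  rcases (pos_le hle).lt_or_eq with hp | hp
  · obtain ⟨q, h1, h2⟩ := exists_rat_btwn hp
    have hq : 0 < (q : ℝ) := x.pos_nonneg.trans_lt h1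
    refine ⟨y.cut x.len q (len_le hle) hq.le fun _ _ _ => hq,
      lt_of_le_of_pos_lt (le_cut_of_eq hle rfl h1.le) (Or.inr (by simpa)),
      lt_of_le_of_pos_lt (cut_le h2.le) ?_, q, by simp⟩
    rcases (len_le hle).lt_or_eq with h | h
    · exact Or.inl h
    · right; rw [h] at h2; rw [cut_pos]; exact h2
  · have hl : x.len < y.len := by
      refine (len_le hle).lt_of_ne fun h => hxy.ne ?_
      refine eq_of_le_of_len_eq hle le_rfl h ?_
      rw [h] at hp; exact hp
    have hs : Order.succ x.len ≤ y.len := Order.succ_le_of_lt hl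
    obtain ⟨q, h1, h2⟩ := exists_rat_btwn (y.coord_pos x.len hl)
    refine ⟨y.cut (Order.succ x.len) q hs h1.le fun _ _ _ => h1,
      lt_of_le_of_pos_lt (le_cut_of_lt hle (Order.lt_succ _)) (Or.inl (Order.lt_succ _)),
      lt_of_le_of_pos_lt (cut_le h2.le) ?_, q, by simp⟩
    rcases hs.lt_or_eq with h | h
    · exact Or.inl h
    · right; rw [h] at h2; rw [cut_pos]; exact h2

/-- For each colour, the exit indices of that colour along the chain have finite initial segments,
since any one of them and all those below it occur in a single node. Only a largest length can fail
to be an exit index. -/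
theorem countable_len_of_isChain {B : Set (RayNode col)} (hB : IsChain (· ≤ ·) B) :
    (len '' B).Countable := by
  let M : ℕ → Set W := fun n => {β | ∃ x ∈ B, β < x.len ∧ pathLabel col x.path β = n}
  have hM : ∀ n, (M n).Countable := fun n => by
    refine Set.countable_of_finite_inter_Iio fun w hw => ?_
    obtain ⟨x, hx, hwx, -⟩ := hw
    refine (x.finite_label n).subset ?_
    rintro β ⟨⟨y, hy, hβy, hl⟩, hβw⟩
    have hβx : β < x.len := lt_trans hβw hwx
    refine ⟨hβx, ?_⟩
    rcases hB.total hx hy with h | h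
    · rw [label_eq h hβx, hl]
    · rw [← label_eq h hβy, hl]
  have hmax : ({w | w ∈ len '' B ∧ ∀ x ∈ B, x.len ≤ w}).Subsingleton := by
    rintro _ ⟨⟨x, hx, rfl⟩, h⟩ _ ⟨⟨y, hy, rfl⟩, h'⟩
    exact le_antisymm (h' x hx) (h y hy)
  refine ((Set.countable_iUnion hM).union hmax.countable).mono fun w hw => ?_
  by_cases h : ∃ x ∈ B, w < x.len
  · obtain ⟨x, hx, hwx⟩ := h
    exact Or.inl (mem_iUnion.2 ⟨_, x, hx, hwx, rfl⟩)
  · push Not at h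
    exact Or.inr ⟨hw, h⟩

theorem mem_of_le_of_isBranch {B : Set (RayNode col)} (hB : IsBranch B) {x y : RayNode col}
    (hx : x ∈ B) (h : y ≤ x) : y ∈ B := by
  have hins : IsChain (· ≤ ·) (insert y B) := hB.1.insert fun z hz _ => by
    rcases hB.1.total hx hz with k | k
    · exact Or.inl (h.trans k)
    · exact le_total_of_le h k
  exact (hB.2 hins (subset_insert y B)).symm ▸ mem_insert y B

variable [WellFoundedLT W]

/-- Two different paths first disagree at an index both nodes reach, because side `0` marks the end
of a path. The meet is on that ray, at the smaller coordinate. -/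
theorem exists_meet (x y : RayNode col) : ∃ m : RayNode col, IsGreatest {z | z ≤ x ∧ z ≤ y} m := by
  by_cases hxy : x.path = y.path
  · have hlen : x.len = y.len := by
      rcases lt_trichotomy x.len y.len with h | h | h
      · exact absurd (hxy ▸ x.side_len) (y.side_ne _ h)
      · exact h
      · exact absurd (hxy ▸ y.side_len) (x.side_ne _ h)
    have : x = y := ext_of hlen (fun _ _ => by rw [hxy]) (by rw [pos, pos, hxy, hlen])
    subst this
    exact ⟨x, ⟨le_rfl, le_rfl⟩, fun z hz => hz.1⟩
  have hne : ({β | x.path β ≠ y.path β} : Set W).Nonempty := by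
    by_contra! h
    exact hxy (funext fun β => by_contra fun hβ => (h ▸ hβ : β ∈ (∅ : Set W)))
  obtain ⟨δ, hδ, hmin⟩ := WellFounded.has_min (wellFounded_lt (α := W)) _ hne
  have hlt : ∀ β < δ, x.path β = y.path β := fun β hβ => by
    by_contra h
    exact hmin β h hβ
  have hlen : ∀ u v : RayNode col, u.path δ ≠ v.path δ → (∀ β < δ, u.path β = v.path β) →
      δ ≤ u.len := fun u v huv h => by
    by_contra! hu
    have h1 : u.len = v.len := by
      rcases lt_trichotomy u.len v.len with k | k | k
      · exact absurd (h _ hu ▸ u.side_len) (v.side_ne _ k)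
      · exact k
      · exact absurd ((h _ (k.trans hu)).symm ▸ v.side_len) (u.side_ne _ k)
    exact huv (by rw [u.path_above δ hu, v.path_above δ (h1 ▸ hu)])
  have hx := hlen x y hδ hlt
  have hy := hlen y x (Ne.symm hδ) fun β hβ => (hlt β hβ).symm
  refine ⟨x.cut δ (min (x.path δ).1 (y.path δ).1) hx (le_min (x.coord_nonneg _) (y.coord_nonneg _))
    (fun β hβ hs => lt_min (x.coord_pos_of_succ_eq hx β hβ hs) (y.coord_pos_of_succ_eq hy β hβ hs)),
    ⟨cut_le (min_le_left _ _), hy, fun β hβ => by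
      rw [cut_path (show β < δ from hβ), hlt β hβ], by simp⟩, ?_⟩
  rintro z ⟨hzx, hzy⟩
  rcases lt_trichotomy z.len δ with h | h | h
  · exact le_cut_of_lt hzx h
  · refine le_cut_of_eq hzx h (le_min ?_ ?_)
    · rw [← h]; exact pos_le hzx
    · rw [← h]; exact pos_le hzy
  · exact absurd ((path_eq hzx h).symm.trans (path_eq hzy h)) hδ

/-- Among upper bounds below `b`, minimise first the index of the last ray, then the coordinate on
it. -/
theorem exists_lub {C : Set (RayNode col)} (hC : C.Nonempty) {b : RayNode col}
    (hb : b ∈ upperBounds C) :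
    ∃ z ≤ b, z ∈ upperBounds C ∧ ∀ u ≤ b, u ∈ upperBounds C → z ≤ u := by
  obtain ⟨c₀, hc₀⟩ := hC
  let U : Set (RayNode col) := {u | u ≤ b ∧ u ∈ upperBounds C}
  obtain ⟨_, ⟨u₀, hu₀, rfl⟩, hmin⟩ := WellFounded.has_min (wellFounded_lt (α := W)) (len '' U)
    ⟨b.len, b, ⟨le_rfl, hb⟩, rfl⟩
  replace hmin : ∀ u ∈ U, u₀.len ≤ u.len := fun u hu => not_lt.1 (hmin _ ⟨u, hu, rfl⟩)
  let T : Set ℝ := pos '' {u | u ∈ U ∧ u.len = u₀.len}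
  have hT : T.Nonempty := ⟨u₀.pos, u₀, ⟨hu₀, rfl⟩, rfl⟩
  have hT0 : BddBelow T := ⟨0, by rintro _ ⟨u, -, rfl⟩; exact u.pos_nonneg⟩
  have ht0 : 0 ≤ sInf T := le_csInf hT (by rintro _ ⟨u, -, rfl⟩; exact u.pos_nonneg)
  have hle : ∀ c ∈ C, c.len = u₀.len → c.pos ≤ sInf T := fun c hc hl =>
    le_csInf hT (by rintro _ ⟨u, hu, rfl⟩; exact pos_le_pos (hu.1.2 hc) (hl.trans hu.2.symm))
  have hδ := len_le hu₀.1
  have htb : sInf T ≤ (b.path u₀.len).1 :=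
    (csInf_le hT0 ⟨u₀, ⟨hu₀, rfl⟩, rfl⟩).trans (pos_le hu₀.1)
  by_cases hpos : ∀ β < u₀.len, Order.succ β = u₀.len → 0 < sInf T
  · refine ⟨b.cut u₀.len (sInf T) hδ ht0 hpos, cut_le htb, fun c hc => ?_, fun u hu huC => ?_⟩
    · rcases (len_le (hu₀.2 hc)).lt_or_eq with h | h
      · exact le_cut_of_lt (hb hc) h
      · exact le_cut_of_eq (hb hc) h (hle c hc h)
    · refine cut_le_of_le hu (hmin u ⟨hu, huC⟩) ?_
      rcases (hmin u ⟨hu, huC⟩).lt_or_eq with h | h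
      · rwa [path_eq hu h]
      · exact csInf_le hT0 ⟨u, ⟨⟨hu, huC⟩, h.symm⟩, by rw [pos, h]⟩
  -- On a successor ray the infimum `0` is not a node. But then no member of `C` reaches that ray,
  -- and the exit point on the preceding ray is an upper bound of smaller length.
  · push Not at hpos
    obtain ⟨β, hβ, hs, ht⟩ := hpos
    have hβb := hβ.le.trans hδ
    refine absurd (hmin (b.cut β (b.path β).1 hβb (b.coord_nonneg β)
      (b.coord_pos_of_succ_eq hβb)) ⟨cut_le le_rfl, fun c hc => ?_⟩) hβ.not_ge
    have hcβ : c.len ≤ β := by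
      have h1 := len_le (hu₀.2 hc)
      rcases h1.lt_or_eq with h | h
      · rw [← hs] at h
        by_contra! hlt
        exact h.not_ge (Order.succ_le_of_lt hlt)
      · have h2 := pos_pos_of_succ (y := c) (h ▸ hβ) (hs.trans h.symm)
        exact absurd (h2.trans_le (hle c hc h)) ht.not_gt
    rcases hcβ.lt_or_eq with h | h
    · exact le_cut_of_lt (hb hc) h
    · exact le_cut_of_eq (hb hc) h (h ▸ pos_le (hb hc))

/-- Within a chain a node is determined by its length and last coordinate, so the nodes with
rational coordinate are countably many. Branches are closed downwards, hence contain the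
interpolated nodes and the suprema. -/
theorem branch_iso [NoMaxOrder W] {B : Set (RayNode col)} (hB : IsBranch B) :
    ∃ I : Set ℝ, I.OrdConnected ∧ Nonempty (B ≃o I) := by
  let _ : LinearOrder B :=
    { (inferInstance : PartialOrder B) with
      le_total := fun a b => hB.1.total a.2 b.2
      toDecidableLE := Classical.decRel _ }
  refine exists_orderIso_ordConnected {x : B | ∃ q : ℚ, x.1.pos = q} ?_ ?_ ?_
  · have hc := (countable_len_of_isChain hB.1).prod (countable_range ((↑) : ℚ → ℝ))
    refine MapsTo.countable_of_injOn (f := fun x : B => (x.1.len, x.1.pos)) ?_ ?_ hc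
    · rintro x ⟨q, hq⟩
      exact ⟨⟨x, x.2, rfl⟩, q, hq.symm⟩
    · rintro x - y - h
      have h1 := congrArg Prod.fst h
      have h2 := congrArg Prod.snd h
      rcases hB.1.total x.2 y.2 with k | k
      · exact Subtype.ext (eq_of_le_of_len_eq k le_rfl h1 h2)
      · exact Subtype.ext (eq_of_le_of_len_eq le_rfl k h1 h2)
  · intro x y h
    obtain ⟨z, h1, h2, h3⟩ := exists_rat_pos_between (show x.1 < y.1 from h)
    exact ⟨⟨z, mem_of_le_of_isBranch hB y.2 h2.le⟩, h3, h1, h2⟩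
  · rintro C ⟨c, hc⟩ ⟨b, hb⟩
    obtain ⟨z, hzb, hz, hmin⟩ := exists_lub (C := (fun x : B => x.1) '' C) ⟨c, c, hc, rfl⟩ (b := b)
      (by rintro _ ⟨d, hd, rfl⟩; exact hb hd)
    refine ⟨⟨z, mem_of_le_of_isBranch hB b.2 hzb⟩, fun d hd => hz ⟨d, hd, rfl⟩, fun u hu => ?_⟩
    rcases hB.1.total u.2 b.2 with k | k
    · exact hmin u k (by rintro _ ⟨d, hd, rfl⟩; exact hu hd)
    · exact hzb.trans k

instance [OrderBot W] [NoMaxOrder W] : IsBranchwiseReal (RayNode col) where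
  branch_iso _ := branch_iso
  exists_meet := exists_meet

end RayNode

/-! ### Directions above a node, and its degree. -/

namespace RayNode

variable {W : Type} [LinearOrder W] {K : Type u} [Zero K] [SuccOrder W]
  {col : W × (W → ℝ × K) → ℝ → ℕ}

open Classical in
/-- The direction in which `y` lies above `x`: the side at which the path of `y` leaves the ray
of `x`, or `0` if it does not leave that ray at `x`. -/
noncomputable def dir (x y : RayNode col) : K :=
  if (y.path x.len).1 = x.pos then (y.path x.len).2 else 0

theorem len_lt_of_coord_eq {x y : RayNode col} (hxy : x < y) (h : (y.path x.len).1 = x.pos) :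
    x.len < y.len := by
  refine (len_le hxy.le).lt_of_ne fun hl => hxy.ne (eq_of_le_of_len_eq hxy.le le_rfl hl ?_)
  rw [hl] at h
  exact h.symm

theorem dir_eq_zero_iff {x y : RayNode col} (hxy : x < y) :
    dir x y = 0 ↔ x.pos < (y.path x.len).1 := by
  unfold dir
  split_ifs with h
  · simp [h, y.side_ne _ (len_lt_of_coord_eq hxy h)]
  · simp [lt_of_le_of_ne (pos_le hxy.le) (Ne.symm h)]

theorem path_eq_of_dir_ne_zero {x y : RayNode col} (h : dir x y ≠ 0) :
    y.path x.len = (x.pos, dir x y) := by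
  unfold dir at h ⊢
  split_ifs at h ⊢ with h'
  · exact Prod.ext h' rfl
  · exact absurd rfl h

/-- The initial segment of the cone above `x` towards `y` is contained in a single ray. -/
theorem exists_initial_ray [NoMaxOrder W] {x y : RayNode col} (hxy : x < y) :
    ∃ (δ : W) (s : ℝ),
      (dir x y = 0 ∧ δ = x.len ∧ s = x.pos ∨ dir x y ≠ 0 ∧ δ = Order.succ x.len ∧ s = 0) ∧
      0 ≤ s ∧ δ ≤ y.len ∧ s < (y.path δ).1 ∧
      ∀ z ≤ y, x < z ↔ δ < z.len ∨ δ = z.len ∧ s < z.pos := by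
  have hx := hxy.le
  by_cases h : dir x y = 0
  · have hp := (dir_eq_zero_iff hxy).1 h
    refine ⟨x.len, x.pos, Or.inl ⟨h, rfl, rfl⟩, x.pos_nonneg, len_le hx, hp, fun z hz => ⟨?_, ?_⟩⟩
    · intro hxz
      rcases (len_le hxz.le).lt_or_eq with hl | hl
      · exact Or.inl hl
      · refine Or.inr ⟨hl, (pos_le_pos hxz.le hl).lt_of_ne fun hpos => hxz.ne ?_⟩
        exact eq_of_le_of_len_eq hx hz hl hpos
    · intro hor
      rcases le_total_of_le hx hz with hxz | hzx
      · exact lt_of_le_of_pos_lt hxz (hor.imp id And.right)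
      · rcases hor with hl | ⟨hl, hpos⟩
        · exact absurd (len_le hzx) hl.not_ge
        · exact absurd (pos_le_pos hzx hl.symm) hpos.not_ge
  · have hp := path_eq_of_dir_ne_zero h
    have hl := len_lt_of_coord_eq hxy (by rw [hp])
    refine ⟨Order.succ x.len, 0, Or.inr ⟨h, rfl, rfl⟩, le_rfl, Order.succ_le_of_lt hl,
      y.coord_pos _ hl, fun z hz => ⟨fun hxz => ?_, fun hor => ?_⟩⟩
    · have hlz : x.len < z.len := by
        refine (len_le hxz.le).lt_of_ne fun hl' => hxz.ne ?_
        refine eq_of_le_of_len_eq hx hz hl' (le_antisymm (pos_le_pos hxz.le hl') ?_)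
        have := pos_le hz
        rwa [← hl', hp] at this
      rcases (Order.succ_le_of_lt hlz).lt_or_eq with h' | h'
      · exact Or.inl h'
      · exact Or.inr ⟨h', pos_pos_of_succ hlz h'⟩
    · have hlz : x.len < z.len := by
        rcases hor with h' | ⟨h', -⟩
        · exact (Order.lt_succ _).trans h'
        · exact (Order.lt_succ _).trans_eq h'
      rcases le_total_of_le hx hz with hxz | hzx
      · exact lt_of_le_of_pos_lt hxz (Or.inl hlz)
      · exact absurd (len_le hzx) hlz.not_ge

theorem dir_eq_of_le {x w y : RayNode col} (hxw : x < w) (hwy : w ≤ y) : dir x w = dir x y := by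
  have hxy := hxw.trans_le hwy
  by_cases h : x.pos < (w.path x.len).1
  · rw [(dir_eq_zero_iff hxw).2 h,
      (dir_eq_zero_iff hxy).2 (h.trans_le (coord_le hwy (len_le hxw.le)))]
  · have hw : (w.path x.len).1 = x.pos := le_antisymm (not_lt.1 h) (pos_le hxw.le)
    have := path_eq hwy (len_lt_of_coord_eq hxw hw)
    simp [dir, this]

/-- Nodes with the same direction start along the same ray, and the smaller of their coordinates on
it gives a common lower bound above `x`. -/
theorem component_iff [OrderBot W] [NoMaxOrder W] {x : RayNode col} (y z : Ioi x) :
    componentSetoid x y z ↔ dir x y = dir x z := by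
  constructor
  · rintro ⟨w, hw, hwy, hwz⟩
    rw [← dir_eq_of_le hw hwy, dir_eq_of_le hw hwz]
  · intro h
    obtain ⟨y, hy⟩ := y
    obtain ⟨z, hz⟩ := z
    replace hy : x < y := hy
    replace hz : x < z := hz
    replace h : dir x y = dir x z := h
    obtain ⟨δ, s, hor, hs, hδ, hlt, hiff⟩ := exists_initial_ray hy
    obtain ⟨δ', s', hor', -, hδ', hlt', -⟩ := exists_initial_ray hz
    obtain ⟨rfl, rfl⟩ : δ' = δ ∧ s' = s := by
      rcases hor with ⟨h1, rfl, rfl⟩ | ⟨h1, rfl, rfl⟩ <;>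
        rcases hor' with ⟨h2, rfl, rfl⟩ | ⟨h2, rfl, rfl⟩
      · exact ⟨rfl, rfl⟩
      · exact absurd (h ▸ h1) h2
      · exact absurd (h ▸ h2) h1
      · exact ⟨rfl, rfl⟩
    have hagree : ∀ β < δ', y.path β = z.path β := fun β hβ => by
      by_cases hβx : β < x.len
      · rw [← path_eq hy.le hβx, path_eq hz.le hβx]
      · rcases hor with ⟨-, rfl, -⟩ | ⟨h1, rfl, -⟩
        · exact absurd hβ hβx
        · have : β = x.len := le_antisymm (Order.le_of_lt_succ hβ) (not_lt.1 hβx)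
          subst this
          rw [path_eq_of_dir_ne_zero h1, path_eq_of_dir_ne_zero (h ▸ h1), h]
    have hmin : s' < min (y.path δ').1 (z.path δ').1 := lt_min hlt hlt'
    have hmin0 := hs.trans_lt hmin
    refine ⟨y.cut δ' _ hδ hmin0.le fun _ _ _ => hmin0, ?_, cut_le (min_le_left _ _), hδ', ?_, ?_⟩
    · exact (hiff _ (cut_le (min_le_left _ _))).2 (Or.inr ⟨rfl, by rwa [cut_pos]⟩)
    · intro β hβ
      rw [cut_path (show β < δ' from hβ), hagree β hβ]
    · simp

theorem finite_label_succ (x : RayNode col) {e : W → ℝ × K} (he : ∀ β < x.len, e β = x.path β)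
    (n : ℕ) : {β | β < Order.succ x.len ∧ pathLabel col e β = n}.Finite := by
  refine ((x.finite_label n).union (finite_singleton x.len)).subset fun β hβ => ?_
  rcases (Order.le_of_lt_succ hβ.1).lt_or_eq with h | h
  · refine Or.inl ⟨h, ?_⟩
    rw [← hβ.2]
    exact pathLabel_congr col fun γ hγ => (he γ (hγ.trans_lt h)).symm
  · exact Or.inr h

theorem exists_dir_eq [NoMaxOrder W] (x : RayNode col) (a : K) : ∃ y, x < y ∧ dir x y = a := by
  classical
  by_cases ha : a = 0
  · subst ha
    have hpos : 0 < x.pos + 1 := by linarith [x.pos_nonneg]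
    let y : RayNode col := glue x.path x.len (x.pos + 1) x.side_ne (fun β _ => x.coord_nonneg β)
      hpos.le (fun β hβ _ => x.coord_pos β hβ) (fun _ _ _ => hpos) x.finite_label
    have hy : (y.path x.len).1 = x.pos + 1 := glue_pos (col := col)
    have hxy : x < y := lt_of_le_of_pos_lt
      ⟨le_rfl, fun β hβ => (glue_path hβ).symm, by rw [hy]; linarith⟩
      (Or.inr (by rw [show y.pos = _ from glue_pos]; linarith))
    exact ⟨y, hxy, (dir_eq_zero_iff hxy).2 (by rw [hy]; linarith)⟩
  · let e : W → ℝ × K := Function.update x.path x.len (x.pos, a)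
    have he : ∀ β < x.len, e β = x.path β := fun β hβ => Function.update_of_ne hβ.ne _ _
    have hel : e x.len = (x.pos, a) := Function.update_self _ _ _
    have hcase : ∀ β < Order.succ x.len, β < x.len ∨ β = x.len := fun β hβ =>
      (Order.le_of_lt_succ hβ).lt_or_eq
    let y : RayNode col := glue e (Order.succ x.len) 1
      (fun β hβ => by
        rcases hcase β hβ with h | rfl
        · rw [he β h]; exact x.side_ne β h
        · rw [hel]; exact ha)
      (fun β hβ => by
        rcases hcase β hβ with h | rfl
        · rw [he β h]; exact x.coord_nonneg β
        · rw [hel]; exact x.pos_nonneg)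
      zero_le_one
      (fun β hβ hs => by
        rcases hcase _ hs with h | h
        · rw [he _ h]; exact x.coord_pos β ((Order.lt_succ β).trans h)
        · rw [h, hel]; exact pos_pos_of_succ ((Order.lt_succ β).trans_eq h) h)
      (fun _ _ _ => one_pos) (x.finite_label_succ he)
    have hyl : y.path x.len = (x.pos, a) := (glue_path (Order.lt_succ _)).trans hel
    refine ⟨y, lt_of_le_of_pos_lt ⟨Order.le_succ _, fun β hβ => ?_, ?_⟩
      (Or.inl (Order.lt_succ _)), ?_⟩
    · rw [glue_path (hβ.trans (Order.lt_succ _)), he β hβ]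
    · rw [hyl]
    · simp [dir, hyl]

theorem treeDegree_eq [OrderBot W] [NoMaxOrder W] (x : RayNode col) :
    treeDegree x = Cardinal.mk K := by
  refine Cardinal.mk_congr (Equiv.ofBijective
    (Quotient.lift (fun y : Ioi x => dir x y) fun y z h => (component_iff y z).1 h) ⟨?_, ?_⟩)
  · rintro ⟨y⟩ ⟨z⟩ h
    exact Quotient.sound ((component_iff y z).2 h)
  · intro a
    obtain ⟨y, hy, h⟩ := exists_dir_eq x a
    exact ⟨Quotient.mk _ ⟨y, hy⟩, h⟩

end RayNode

/-! ### Rigidity from a generic colouring. -/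

/-- For distinct rays and any order isomorphism between open intervals of them, there are
corresponding points of colour `n` on the first ray and `0` on the second. -/
def IsMutuallyGeneric {R : Type*} (col : R → ℝ → ℕ) : Prop :=
  ∀ r r' : R, r ≠ r' → ∀ a b c d : ℝ, a < b → ∀ g : ℝ → ℝ, StrictMonoOn g (Ioo a b) →
    g '' Ioo a b = Ioo c d → ∀ n : ℕ, ∃ t ∈ Ioo a b, col r t = n ∧ col r' (g t) = 0

namespace RayNode

variable {W : Type} [LinearOrder W] {K : Type u} [Zero K] [SuccOrder W]
  {col : W × (W → ℝ × K) → ℝ → ℕ}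

/-- The colour of a node on its last ray. -/
noncomputable def color (x : RayNode col) : ℕ := pathLabel col x.path x.len

theorem len_lt_of_dir_ne_zero {x y : RayNode col} (hxy : x < y) (h : dir x y ≠ 0) :
    x.len < y.len :=
  len_lt_of_coord_eq hxy (by rw [path_eq_of_dir_ne_zero h])

/-- Links colours of nodes to the finiteness condition: a path that leaves its ray at `x` records
the colour of `x` as a label. -/
theorem label_of_dir_ne_zero {x y : RayNode col} (hxy : x < y) (h : dir x y ≠ 0) :
    pathLabel col y.path x.len = color x := by
  have h1 : (Iio x.len).indicator y.path = (Iio x.len).indicator x.path := by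
    refine indicator_congr fun β hβ => (path_eq hxy.le hβ).symm
  simp only [color, pathLabel, h1, path_eq_of_dir_ne_zero h]
  rfl

theorem color_eq {x y : RayNode col} (h : x ≤ y) :
    color x = col (x.len, (Iio x.len).indicator y.path) x.pos := by
  have h1 : (Iio x.len).indicator y.path = (Iio x.len).indicator x.path := by
    refine indicator_congr fun β hβ => (path_eq h hβ).symm
  simp only [color, pathLabel, h1]
  rfl

/-- Near `x` and `f x`, the isomorphism `f` maps an interval of one ray onto an interval of another,
and genericity applies. Taking `y ≤ u` lets the caller prescribe the direction, both of `y` from `x`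
and of `f y` from `f x`. -/
theorem exists_step [NoMaxOrder W] (hgen : IsMutuallyGeneric col)
    (f : RayNode col ≃o RayNode col) {x u : RayNode col} (hxu : x < u) (hx : ¬ x ≤ f x)
    (hx' : ¬ f x ≤ x) (n : ℕ) :
    ∃ y, x < y ∧ y ≤ u ∧ (y.len = x.len ∨ y.len = Order.succ x.len ∧ dir x y ≠ 0) ∧
      color y = n ∧ color (f y) = 0 := by
  obtain ⟨δ, s, hor, hs, hδ, hlt, hiff⟩ := exists_initial_ray hxu
  -- Shrink twice: first so that the segment above `x` lies on one ray, then so that its image above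
  -- `f x` does too.
  let u₁ := u.cut δ _ hδ (u.coord_nonneg δ) (u.coord_pos_of_succ_eq hδ)
  have hu₁ : u₁ ≤ u := cut_le le_rfl
  have hxu₁ : x < u₁ := (hiff _ hu₁).2 (Or.inr ⟨rfl, by rwa [cut_pos]⟩)
  obtain ⟨δ', s', -, hs', hδ', hlt', hiff'⟩ := exists_initial_ray (f.strictMono hxu₁)
  obtain ⟨v, hv, hvl, hpv⟩ : ∃ v ≤ f u₁, v.len = δ' ∧ s' < v.pos :=
    ⟨(f u₁).cut δ' _ hδ' ((f u₁).coord_nonneg δ') ((f u₁).coord_pos_of_succ_eq hδ'),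
      cut_le le_rfl, rfl, by rwa [cut_pos]⟩
  have hxv : f x < v := (hiff' _ hv).2 (Or.inr ⟨hvl.symm, hpv⟩)
  obtain ⟨u₂, hu₂⟩ := f.surjective v
  have hu₂₁ : u₂ ≤ u₁ := f.le_iff_le.1 (hu₂ ▸ hv)
  have hxu₂ : x < u₂ := f.lt_iff_lt.1 (hu₂ ▸ hxv)
  obtain ⟨hl₂, hp₂⟩ : δ = u₂.len ∧ s < u₂.pos := by
    rcases (hiff _ (hu₂₁.trans hu₁)).1 hxu₂ with h | h
    · exact absurd (len_le hu₂₁) (not_le.2 h)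
    · exact h
  -- points strictly between `x` and `u₂` lie on one ray, and so do their images
  have hseg : ∀ z ≤ u₂, x < z → z.len = δ ∧ s < z.pos := fun z hz hxz => by
    rcases (hiff z (hz.trans (hu₂₁.trans hu₁))).1 hxz with h | h
    · exact absurd (len_le hz) (not_le.2 (hl₂ ▸ h))
    · exact ⟨h.1.symm, h.2⟩
  have hseg' : ∀ z ≤ v, f x < z → z.len = δ' ∧ s' < z.pos := fun z hz hxz => by
    rcases (hiff' z (hz.trans hv)).1 hxz with h | h
    · exact absurd (len_le hz) (not_le.2 (hvl ▸ h))
    · exact ⟨h.1.symm, h.2⟩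
  have hz : ∀ t : ℝ, ∃ z : RayNode col, t ∈ Ioo s u₂.pos →
      z.pos = t ∧ x < z ∧ z ≤ u₂ ∧ z.len = δ := fun t => by
    by_cases ht : t ∈ Ioo s u₂.pos
    · have h0 : 0 < t := hs.trans_lt ht.1
      have hle : u₂.cut δ t hl₂.le h0.le (fun _ _ _ => h0) ≤ u₂ := by
        refine cut_le ?_
        rw [hl₂]; exact ht.2.le
      exact ⟨_, fun _ => ⟨cut_pos, (hiff _ (hle.trans (hu₂₁.trans hu₁))).2
        (Or.inr ⟨rfl, by rw [cut_pos]; exact ht.1⟩), hle, rfl⟩⟩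
    · exact ⟨x, fun h => absurd h ht⟩
  choose z hz using hz
  have hfz : ∀ t ∈ Ioo s u₂.pos, f (z t) ≤ v ∧ (f (z t)).len = δ' ∧ s' < (f (z t)).pos :=
    fun t ht => by
      obtain ⟨-, h1, h2, -⟩ := hz t ht
      have h3 : f (z t) ≤ v := hu₂ ▸ f.monotone h2
      exact ⟨h3, hseg' _ h3 (f.strictMono h1)⟩
  have hmono : StrictMonoOn (fun t => (f (z t)).pos) (Ioo s u₂.pos) := fun t ht t' ht' htt' => by
    obtain ⟨h1, -, h2, h3⟩ := hz t ht
    obtain ⟨h1', -, h2', h3'⟩ := hz t' ht'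
    have hne : z t ≠ z t' := fun h => htt'.ne (by rw [← h1, ← h1', h])
    have hlt : z t < z t' := by
      refine lt_of_le_of_ne ((le_total_of_le h2 h2').resolve_right fun h => ?_) hne
      have := pos_le_pos h (h3'.trans h3.symm)
      rw [h1, h1'] at this
      exact htt'.not_ge this
    have hl := (hfz t ht).2.1.trans (hfz t' ht').2.1.symm
    refine (pos_le_pos (f.monotone hlt.le) hl).lt_of_ne fun h => hne (f.injective ?_)
    exact eq_of_le_of_len_eq (hfz t ht).1 (hfz t' ht').1 hl h
  have himage : (fun t => (f (z t)).pos) '' Ioo s u₂.pos = Ioo s' v.pos := by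
    ext r
    constructor
    · rintro ⟨t, ht, rfl⟩
      obtain ⟨h1, h2, h3⟩ := hfz t ht
      refine ⟨h3, (pos_le_pos h1 (h2.trans hvl.symm)).lt_of_ne fun h => ?_⟩
      have h4 := eq_of_le_of_len_eq h1 le_rfl (h2.trans hvl.symm) h
      have h5 : z t = u₂ := f.injective (h4.trans hu₂.symm)
      have h6 := (hz t ht).1
      rw [h5] at h6
      exact ht.2.ne h6.symm
    · intro hr
      have h0 : 0 < r := hs'.trans_lt hr.1
      have hle : v.cut δ' r hvl.ge h0.le (fun _ _ _ => h0) ≤ v := by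
        refine cut_le ?_
        rw [← hvl]; exact hr.2.le
      obtain ⟨y, hy⟩ := f.surjective (v.cut δ' r hvl.ge h0.le (fun _ _ _ => h0))
      have hyv : f y ≤ v := hy ▸ hle
      have hxy : f x < f y := by
        refine (hiff' _ (hyv.trans hv)).2 (Or.inr ?_)
        rw [hy]
        exact ⟨rfl, by rw [cut_pos]; exact hr.1⟩
      have hyu : y ≤ u₂ := f.le_iff_le.1 (hu₂ ▸ hyv)
      obtain ⟨h1, h2⟩ := hseg y hyu (f.lt_iff_lt.1 hxy)
      have hyp : y.pos ∈ Ioo s u₂.pos := by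
        refine ⟨h2, (pos_le_pos hyu (h1.trans hl₂)).lt_of_ne fun h => ?_⟩
        have h3 := eq_of_le_of_len_eq hyu le_rfl (h1.trans hl₂) h
        rw [h3, hu₂] at hy
        have := congrArg pos hy
        rw [cut_pos] at this
        exact hr.2.ne this.symm
      obtain ⟨k1, -, k2, k3⟩ := hz _ hyp
      have : z y.pos = y := eq_of_le_of_len_eq k2 hyu (k3.trans h1.symm) k1
      refine ⟨y.pos, hyp, ?_⟩
      simp only [this, hy, cut_pos]
  have hxv' : ¬ u₂ ≤ v ∧ ¬ v ≤ u₂ := by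
    constructor
    · intro h
      exact (le_total_of_le (hxu₂.le.trans h) hxv.le).elim hx hx'
    · intro h
      exact (le_total_of_le hxu₂.le (hxv.le.trans h)).elim hx hx'
  -- On a common ray `u₂` and `v` would be comparable, and then so would `x` and `f x`.
  have hne : (δ, (Iio δ).indicator u₂.path) ≠ (δ', (Iio δ').indicator v.path) := by
    intro h
    obtain rfl : δ = δ' := congrArg Prod.fst h
    have h2 : (Iio δ).indicator u₂.path = (Iio δ).indicator v.path := congrArg Prod.snd h
    have hp : ∀ β < δ, u₂.path β = v.path β := fun β hβ => by
      have := congrFun h2 β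
      rwa [indicator_of_mem (show β ∈ Iio δ from hβ),
        indicator_of_mem (show β ∈ Iio δ from hβ)] at this
    rcases le_total u₂.pos v.pos with h | h
    · refine hxv'.1 ⟨(hl₂.symm.trans hvl.symm).le, fun β hβ => hp β (hβ.trans_eq hl₂.symm), ?_⟩
      rw [← hl₂, ← hvl]; exact h
    · refine hxv'.2 ⟨(hvl.trans hl₂).le, fun β hβ => (hp β (hβ.trans_eq hvl)).symm, ?_⟩
      rw [hvl, hl₂]; exact h
  obtain ⟨t, ht, h1, h2⟩ := hgen _ _ hne s u₂.pos s' v.pos hp₂ _ hmono himage n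
  obtain ⟨k1, k2, k3, k4⟩ := hz t ht
  have hzu : z t ≤ u := k3.trans (hu₂₁.trans hu₁)
  refine ⟨z t, k2, hzu, ?_, ?_, ?_⟩
  · rw [k4, dir_eq_of_le k2 hzu]
    rcases hor with ⟨-, h, -⟩ | ⟨h, h', -⟩
    · exact Or.inl h
    · exact Or.inr ⟨h', h⟩
  · rw [color_eq k3, k4, k1, h1]
  · rw [color_eq (hfz t ht).1, (hfz t ht).2.1, h2]

/-- The lengths have a least bound `l`, not attained and hence not a successor. The union of the
paths is continued by coordinate `0` on the ray `l`, which is allowed there. -/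
theorem exists_upper_bound_of_monotone [WellFoundedLT W] [Uncountable W]
    (hW : ∀ w : W, (Iio w).Countable) {x : ℕ → RayNode col} (hx : Monotone x)
    (hlen : ∀ n, ∃ m, (x n).len < (x m).len)
    (hfin : ∀ k, {β | ∃ n, β < (x n).len ∧ pathLabel col (x n).path β = k}.Finite) :
    ∃ p, ∀ n, x n ≤ p := by
  have hbdd : {w : W | ∀ n, (x n).len ≤ w}.Nonempty := by
    by_contra! h
    refine Set.not_countable_univ (α := W)
      ((countable_iUnion fun n => hW (x n).len).mono fun w _ => ?_)
    by_contra hw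
    simp only [mem_iUnion, mem_Iio, not_exists, not_lt] at hw
    exact (h ▸ hw : w ∈ (∅ : Set W))
  obtain ⟨l, hl, hmin⟩ := WellFounded.has_min (wellFounded_lt (α := W)) _ hbdd
  have hex : ∀ β < l, ∃ n, β < (x n).len := fun β hβ => by
    by_contra! h
    exact hmin β h hβ
  have hltl : ∀ n, (x n).len < l := fun n => (hlen n).elim fun m hm => hm.trans_le (hl m)
  have hpath : ∀ m n β, β < (x m).len → β < (x n).len → (x m).path β = (x n).path β :=
    fun m n β hm hn => by
      rcases le_total m n with h | h
      · exact path_eq (hx h) hm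
      · exact (path_eq (hx h) hn).symm
  have he : ∀ β, ∃ v : ℝ × K, ∀ n, β < (x n).len → v = (x n).path β := fun β => by
    by_cases h : ∃ n, β < (x n).len
    · obtain ⟨m, hm⟩ := h
      exact ⟨(x m).path β, fun n hn => hpath m n β hm hn⟩
    · exact ⟨0, fun n hn => absurd ⟨n, hn⟩ h⟩
  choose e he using he
  refine ⟨glue e l 0 ?_ ?_ le_rfl ?_ ?_ fun k => ?_, fun n => ⟨hl n, fun β hβ => ?_, ?_⟩⟩
  · intro β hβ
    obtain ⟨n, hn⟩ := hex β hβ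
    rw [he β n hn]
    exact (x n).side_ne β hn
  · intro β hβ
    obtain ⟨n, hn⟩ := hex β hβ
    rw [he β n hn]
    exact (x n).coord_nonneg β
  · intro β hβ hs
    obtain ⟨n, hn⟩ := hex _ hs
    rw [he _ n hn]
    exact (x n).coord_pos β ((Order.le_succ β).trans_lt hn)
  · intro β hβ hs
    obtain ⟨n, hn⟩ := hex β hβ
    exact absurd (hs ▸ Order.succ_le_of_lt hn) (hltl n).not_ge
  · refine (hfin k).subset fun β hβ => ?_
    obtain ⟨n, hn⟩ := hex β hβ.1
    refine ⟨n, hn, ?_⟩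
    rw [← hβ.2]
    exact pathLabel_congr col fun γ hγ => (he γ n (hγ.trans_lt hn)).symm
  · rw [glue_path (hβ.trans (hltl n)), he β n hβ]
  · obtain ⟨m, hm⟩ := hlen n
    rw [glue_path (hltl n), he _ m hm]
    have hnm : n ≤ m := by
      by_contra! h
      exact (len_le (hx h.le)).not_gt hm
    exact pos_le (hx hnm)

/-- If every node were comparable with its image and `x < g x`, take `y > x` in a direction other
than that of `g x`. Then `g y > g x`, so comparing `y` with `g y` puts one node above `x` in both
directions. -/
theorem exists_incomparable [OrderBot W] [NoMaxOrder W] [Nontrivial K]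
    {f : RayNode col ≃o RayNode col} (hf : f ≠ OrderIso.refl _) : ∃ x, ¬ x ≤ f x ∧ ¬ f x ≤ x := by
  by_contra! hcon
  obtain ⟨x, hx⟩ : ∃ x, f x ≠ x := by
    by_contra! h
    exact hf (OrderIso.ext (funext h))
  have key : ∀ g : RayNode col ≃o RayNode col, (∀ y, y ≤ g y ∨ g y ≤ y) → ¬ x < g x := by
    intro g hg hlt
    obtain ⟨a, ha⟩ := exists_ne (dir x (g x))
    obtain ⟨y, hy, hya⟩ := exists_dir_eq x a
    have hgy : g x < g y := g.strictMono hy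
    have hw : ∀ w, w ≤ y → w ≤ g x → x < w → False := fun w h1 h2 h3 =>
      ha (by rw [← hya, ← dir_eq_of_le h3 h1, ← dir_eq_of_le h3 h2])
    rcases hg y with h | h
    · rcases le_total_of_le h hgy.le with k | k
      · exact hw y le_rfl k hy
      · exact hw _ k le_rfl hlt
    · exact hw _ (hgy.le.trans h) le_rfl hlt
  have hcon' : ∀ y, y ≤ f y ∨ f y ≤ y := fun y => or_iff_not_imp_left.2 (hcon y)
  rcases hcon' x with h | h
  · exact key f hcon' (lt_of_le_of_ne h hx.symm)
  · refine key f.symm (fun y => ?_) (f.lt_iff_lt.1 ?_)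
    · rcases hcon' (f.symm y) with k | k <;> rw [f.apply_symm_apply] at k
      · exact Or.inr k
      · exact Or.inl k
    · rw [f.apply_symm_apply]
      exact lt_of_le_of_ne h hx

/-- Two components above `x` have distinct images, and only one component above `f x` has direction
`0`. -/
theorem exists_image_dir_ne_zero [OrderBot W] [NoMaxOrder W] [Nontrivial K]
    (f : RayNode col ≃o RayNode col) (x : RayNode col) : ∃ u, x < u ∧ dir (f x) (f u) ≠ 0 := by
  obtain ⟨a, b, hab⟩ := exists_pair_ne K
  obtain ⟨u, hu, hua⟩ := exists_dir_eq x a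
  obtain ⟨v, hv, hvb⟩ := exists_dir_eq x b
  by_contra! h
  obtain ⟨w, hw, hwu, hwv⟩ := (component_iff (⟨f u, f.strictMono hu⟩ : Ioi (f x))
    ⟨f v, f.strictMono hv⟩).2 ((h u hu).trans (h v hv).symm)
  obtain ⟨w, rfl⟩ := f.surjective w
  have hxw := f.lt_iff_lt.1 hw
  refine hab ?_
  rw [← hua, ← hvb, ← dir_eq_of_le hxw (f.le_iff_le.1 hwu), ← dir_eq_of_le hxw (f.le_iff_le.1 hwv)]

/-- Even steps leave the current ray of `x k`, making the lengths grow; odd steps do so for the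
images, making their colours `0` into labels. -/
theorem isOrderRigid [OrderBot W] [NoMaxOrder W] [WellFoundedLT W] [Uncountable W] [Nontrivial K]
    (hW : ∀ w : W, (Iio w).Countable) (hgen : IsMutuallyGeneric col) :
    IsOrderRigid (RayNode col) := by
  intro f
  by_contra hf
  obtain ⟨x₀, hx₀, hx₀'⟩ := exists_incomparable hf
  let S := {x : RayNode col // ¬ x ≤ f x ∧ ¬ f x ≤ x}
  have hstep : ∀ (k : ℕ) (x : S), ∃ y : S, x.1 < y.1 ∧
      (y.1.len = x.1.len ∨ y.1.len = Order.succ x.1.len ∧ dir x.1 y.1 ≠ 0) ∧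
      color y.1 = k + 1 ∧ color (f y.1) = 0 ∧ (Even k → dir x.1 y.1 ≠ 0) ∧
      (¬ Even k → dir (f x.1) (f y.1) ≠ 0) := by
    rintro k ⟨x, hx, hx'⟩
    obtain ⟨u, hxu, hu1, hu2⟩ : ∃ u, x < u ∧ (Even k → dir x u ≠ 0) ∧
        (¬ Even k → dir (f x) (f u) ≠ 0) := by
      by_cases hk : Even k
      · obtain ⟨a, ha⟩ := exists_ne (0 : K)
        obtain ⟨u, hu, hua⟩ := exists_dir_eq x a
        exact ⟨u, hu, fun _ => hua ▸ ha, fun h => absurd hk h⟩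
      · obtain ⟨u, hu, hne⟩ := exists_image_dir_ne_zero f x
        exact ⟨u, hu, fun h => absurd h hk, fun _ => hne⟩
    obtain ⟨y, hxy, hyu, h1, h2, h3⟩ := exists_step hgen f hxu hx hx' (k + 1)
    have hfxy : f x < f y := f.strictMono hxy
    refine ⟨⟨y, fun h => ?_, fun h => ?_⟩, hxy, h1, h2, h3, fun h => ?_, fun h => ?_⟩
    · exact (le_total_of_le (hxy.le.trans h) hfxy.le).elim hx hx'
    · exact (le_total_of_le hxy.le (hfxy.le.trans h)).elim hx hx'
    · rw [dir_eq_of_le hxy hyu]; exact hu1 h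
    · rw [dir_eq_of_le hfxy (f.monotone hyu)]; exact hu2 h
  choose next hnext using hstep
  let s : ℕ → S := Nat.rec ⟨x₀, hx₀, hx₀'⟩ next
  let x : ℕ → RayNode col := fun k => (s k).1
  have hlt : ∀ k, x k < x (k + 1) := fun k => (hnext k (s k)).1
  have hor : ∀ k, (x (k + 1)).len = (x k).len ∨
      (x (k + 1)).len = Order.succ (x k).len ∧ dir (x k) (x (k + 1)) ≠ 0 :=
    fun k => (hnext k (s k)).2.1
  have hcol : ∀ k, color (x (k + 1)) = k + 1 := fun k => (hnext k (s k)).2.2.1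
  have hcol' : ∀ k, color (f (x (k + 1))) = 0 := fun k => (hnext k (s k)).2.2.2.1
  have heven : ∀ k, Even k → dir (x k) (x (k + 1)) ≠ 0 := fun k => (hnext k (s k)).2.2.2.2.1
  have hodd : ∀ k, ¬ Even k → dir (f (x k)) (f (x (k + 1))) ≠ 0 :=
    fun k => (hnext k (s k)).2.2.2.2.2
  have hmono : Monotone x := monotone_nat_of_le_succ fun k => (hlt k).le
  have hlabel : ∀ n β, β < (x n).len → (x 0).len ≤ β →
      ∃ m, β = (x m).len ∧ pathLabel col (x n).path β = color (x m) := by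
    intro n
    induction n with
    | zero => intro β h1 h2; exact absurd h1 h2.not_gt
    | succ n ih =>
      intro β h1 h2
      by_cases hβ : β < (x n).len
      · obtain ⟨m, hm1, hm2⟩ := ih β hβ h2
        exact ⟨m, hm1, by rw [← label_eq (hlt n).le hβ, hm2]⟩
      · rcases hor n with h | ⟨h, hd⟩
        · exact absurd (h ▸ h1) hβ
        · rw [h] at h1
          obtain rfl : β = (x n).len := le_antisymm (Order.le_of_lt_succ h1) (not_lt.1 hβ)
          exact ⟨n, rfl, label_of_dir_ne_zero (hlt n) hd⟩
  obtain ⟨p, hp⟩ : ∃ p, ∀ n, x n ≤ p := by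
    refine exists_upper_bound_of_monotone hW hmono (fun n => ?_) (fun k => ?_)
    · refine ⟨2 * n + 1, (len_le (hmono (by omega : n ≤ 2 * n))).trans_lt ?_⟩
      exact len_lt_of_dir_ne_zero (hlt _) (heven _ (even_two_mul n))
    -- Beyond the path of `x 0`, labels are colours of the `x m`. As `x m` has colour `m` for `m ≥
    -- 1`, label `k` can arise only from `x k` and possibly `x 0`.
    · refine (((x 0).finite_label k).union (toFinite {(x 0).len, (x k).len})).subset ?_
      rintro β ⟨n, hn, hk⟩
      by_cases hβ : β < (x 0).len
      · exact Or.inl ⟨hβ, by rw [label_eq (hmono n.zero_le) hβ, hk]⟩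
      · obtain ⟨m, rfl, hm⟩ := hlabel n β hn (not_lt.1 hβ)
        cases m with
        | zero => exact Or.inr (Or.inl rfl)
        | succ m =>
          rw [hm, hcol] at hk
          exact Or.inr (Or.inr (by rw [← hk]; rfl))
  have hfp : ∀ n, f (x n) ≤ f p := fun n => f.monotone (hp n)
  have hflt : ∀ k, f (x k) < f (x (k + 1)) := fun k => f.strictMono (hlt k)
  have hflen : ∀ n, (f (x (2 * n + 1))).len < (f (x (2 * n + 2))).len := fun n =>
    len_lt_of_dir_ne_zero (hflt (2 * n + 1)) (hodd _ (by simp))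
  have hinj : StrictMono fun n => (f (x (2 * n + 1))).len := strictMono_nat_of_lt_succ fun n =>
    (hflen n).trans_le (len_le (f.monotone (hmono (by omega : 2 * n + 2 ≤ 2 * (n + 1) + 1))))
  refine infinite_of_injective_forall_mem hinj.injective (fun n => ?_) ((f p).finite_label 0)
  refine ⟨(hflen n).trans_le (len_le (hfp (2 * n + 2))), ?_⟩
  rw [← label_eq (hfp (2 * n + 2)) (hflen n),
    label_of_dir_ne_zero (hflt (2 * n + 1)) (hodd _ (by simp)), hcol']

end RayNode

/-! ### Construction of the generic colouring. -/

section Colouring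

open Cardinal

/-- Recursion along a well-order of `P` in which each element has fewer than continuum many
predecessors. The forbidden set is smaller than the continuum, and so is its preimage under the
injective `g p`, so `I p` is not exhausted. -/
theorem exists_separated_points {P : Type} (hP : #P ≤ 𝔠) (I : P → Set ℝ) (hI : ∀ p, 𝔠 ≤ #(I p))
    (g : P → ℝ → ℝ) (hg : ∀ p, InjOn (g p) (I p)) (N : Set ℝ) (hN : N.Countable) :
    ∃ y : P → ℝ, (∀ p, y p ∈ I p ∧ y p ∉ N ∧ g p (y p) ∉ N) ∧
      ∀ p q a, (a = y p ∨ a = g p (y p)) → (a = y q ∨ a = g q (y q)) → p = q := by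
  obtain ⟨r, hr, hord⟩ := exists_ord_eq P
  let F : ∀ p, (∀ q, r q p → ℝ) → Set ℝ := fun p prev =>
    N ∪ (range (fun q : {q // r q p} => prev q q.2) ∪
      range fun q : {q // r q p} => g q (prev q q.2))
  have hF : ∀ p prev, #(F p prev) < 𝔠 := fun p prev => by
    have h1 : #{q // r q p} < 𝔠 := (card_typein_lt p hord).trans_le hP
    have h2 : #N < 𝔠 := (le_aleph0_iff_set_countable.2 hN).trans_lt aleph0_lt_continuum
    refine (mk_union_le _ _).trans_lt (add_lt_of_lt aleph0_le_continuum h2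
      ((mk_union_le _ _).trans_lt (add_lt_of_lt aleph0_le_continuum ?_ ?_)))
    · exact mk_range_le.trans_lt h1
    · exact mk_range_le.trans_lt h1
  have hstep : ∀ p prev, ∃ y ∈ I p, y ∉ F p prev ∧ g p y ∉ F p prev := fun p prev => by
    by_contra! h
    have hsub : I p ⊆ F p prev ∪ (I p ∩ g p ⁻¹' F p prev) := fun y hy => by
      by_cases hyF : y ∈ F p prev
      · exact Or.inl hyF
      · exact Or.inr ⟨hy, h y hy hyF⟩
    have h1 : #(I p ∩ g p ⁻¹' F p prev : Set ℝ) < 𝔠 := by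
      rw [← mk_image_eq_of_injOn _ _ ((hg p).mono inter_subset_left)]
      refine (mk_le_mk_of_subset ?_).trans_lt (hF p prev)
      rintro _ ⟨y, hy, rfl⟩
      exact hy.2
    exact (hI p).not_gt ((mk_le_mk_of_subset hsub).trans_lt ((mk_union_le _ _).trans_lt
      (add_lt_of_lt aleph0_le_continuum (hF p prev) h1)))
  choose next hnext1 hnext2 hnext3 using hstep
  have hwf : WellFounded r := hr.wf
  let y : P → ℝ := hwf.fix next
  have hy : ∀ p, y p = next p fun q _ => y q := fun p => hwf.fix_eq next p
  have hmemF : ∀ p q a, r q p → (a = y q ∨ a = g q (y q)) → a ∈ F p fun q _ => y q := by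
    rintro p q a hqp (rfl | rfl)
    · exact Or.inr (Or.inl ⟨⟨q, hqp⟩, rfl⟩)
    · exact Or.inr (Or.inr ⟨⟨q, hqp⟩, rfl⟩)
  have hnotF : ∀ p a, (a = y p ∨ a = g p (y p)) → a ∉ F p fun q _ => y q := by
    rintro p a (rfl | rfl)
    · have := hnext2 p fun q _ => y q
      rwa [← hy] at this
    · have := hnext3 p fun q _ => y q
      rwa [← hy] at this
  refine ⟨y, fun p => ⟨?_, ?_, ?_⟩, fun p q a hp hq => ?_⟩
  · have := hnext1 p fun q _ => y q
    rwa [← hy] at this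
  · exact fun h => hnotF p _ (Or.inl rfl) (Or.inl h)
  · exact fun h => hnotF p _ (Or.inr rfl) (Or.inl h)
  · rcases trichotomous_of r p q with h | h | h
    · exact absurd (hmemF q p a h hp) (hnotF q a hq)
    · exact h
    · exact absurd (hmemF p q a h hq) (hnotF p a hp)

/-- The left limit along the rationals above `a` of a function defined on the rationals. -/
noncomputable def ratSup (h : ℚ → ℝ) (a y : ℝ) : ℝ :=
  sSup (h '' {q : ℚ | a < q ∧ (q : ℝ) < y})

/-- A strictly monotone map onto an interval has no jumps, so its rational values determine it. Thus
continuum many codes cover all maps to be handled. -/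
theorem ratSup_eq {a b c d : ℝ} {g : ℝ → ℝ} (hg : StrictMonoOn g (Ioo a b))
    (himage : g '' Ioo a b = Ioo c d) {y : ℝ} (hy : y ∈ Ioo a b) :
    ratSup (fun q => g q) a y = g y := by
  have hmem : ∀ q : ℚ, a < q → (q : ℝ) < y → (q : ℝ) ∈ Ioo a b := fun q h1 h2 =>
    ⟨h1, h2.trans hy.2⟩
  have hgy : g y ∈ Ioo c d := himage ▸ mem_image_of_mem g hy
  refine IsLUB.csSup_eq ⟨?_, fun u hu => ?_⟩ ?_
  · rintro _ ⟨q, ⟨h1, h2⟩, rfl⟩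
    exact (hg (hmem q h1 h2) hy h2).le
  · by_contra! hlt
    obtain ⟨s, hs1, hs2⟩ := exists_between (max_lt hlt hgy.1)
    have hs : s ∈ g '' Ioo a b :=
      himage ▸ ⟨(le_max_right _ _).trans_lt hs1, hs2.trans hgy.2⟩
    obtain ⟨t, ht, rfl⟩ := hs
    obtain ⟨q, h1, h2⟩ := exists_rat_btwn ((hg.lt_iff_lt ht hy).1 hs2)
    have hq := hmem q (ht.1.trans h1) h2
    exact (hu ⟨q, ⟨hq.1, h2⟩, rfl⟩).not_gt
      (((le_max_left _ _).trans_lt hs1).trans (hg ht hq h1))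
  · obtain ⟨q, h1, h2⟩ := exists_rat_btwn hy.1
    exact ⟨g q, q, ⟨h1, h2⟩, rfl⟩

/-- Each task `p` codes a map, a real `i`, a bit and a colour, and owns the points `y p` and `z p`.
Both get the colour in `χ A` if membership of `i` in `A` agrees with the bit, and `0` otherwise. For
`A ≠ B`, take `i` separating them and the bit of `A`. The points `n + 2` are kept free for embedding
`T`. -/
theorem exists_isMutuallyGeneric :
    ∃ χ : Set ℝ → ℝ → ℕ, IsMutuallyGeneric χ ∧ ∀ A (n : ℕ), χ A (n + 2) = n := by
  classical
  let D := {d : (ℚ → ℝ) × ℝ × ℝ // d.2.1 < d.2.2 ∧ InjOn (ratSup d.1 d.2.1) (Ioo d.2.1 d.2.2)}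
  let P := D × ℝ × Bool × ℕ
  have hD : #D ≤ 𝔠 := (mk_subtype_le _).trans (by simp [mk_real])
  have hP : #P ≤ 𝔠 := by
    have : #P = #D * (#ℝ * (#Bool * #ℕ)) := by simp [P]
    rw [this]
    calc #D * (#ℝ * (#Bool * #ℕ)) ≤ 𝔠 * (#ℝ * (#Bool * #ℕ)) := by gcongr
      _ = 𝔠 := by simp [mk_real]
  obtain ⟨y, hy, hsep⟩ := exists_separated_points hP (fun p => Ioo p.1.1.2.1 p.1.1.2.2)
    (fun p => (mk_Ioo_real p.1.2.1).ge) (fun p => ratSup p.1.1.1 p.1.1.2.1) (fun p => p.1.2.2)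
    (range fun n : ℕ => (n : ℝ) + 2) (countable_range _)
  let z : P → ℝ := fun p => ratSup p.1.1.1 p.1.1.2.1 (y p)
  let χ : Set ℝ → ℝ → ℕ := fun A t =>
    if h : ∃ n : ℕ, t = n + 2 then h.choose
    else if h : ∃ p, t = y p ∨ t = z p then
      (if (h.choose.2.1 ∈ A ↔ h.choose.2.2.1 = true) then h.choose.2.2.2 else 0) else 0
  have hχ : ∀ A p t, (t = y p ∨ t = z p) →
      χ A t = if (p.2.1 ∈ A ↔ p.2.2.1 = true) then p.2.2.2 else 0 := fun A p t ht => by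
    have h1 : ¬ ∃ n : ℕ, t = n + 2 := by
      rintro ⟨n, hn⟩
      rcases ht with h | h
      · exact (hy p).2.1 ⟨n, by rw [← h, hn]⟩
      · exact (hy p).2.2 ⟨n, by change _ = z p; rw [← h, hn]⟩
    have h2 : ∃ p, t = y p ∨ t = z p := ⟨p, ht⟩
    have h3 : h2.choose = p := hsep _ _ t h2.choose_spec ht
    simp only [χ, dif_neg h1, dif_pos h2, h3]
  refine ⟨χ, fun A B hAB a b c d hab g hg himage n => ?_, fun A n => ?_⟩
  · obtain ⟨i, hi⟩ : ∃ i, ¬ (i ∈ A ↔ i ∈ B) := by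
      by_contra! h
      exact hAB (Set.ext h)
    have hinj : InjOn (ratSup (fun q => g q) a) (Ioo a b) :=
      hg.injOn.congr fun t ht => (ratSup_eq hg himage ht).symm
    let p : P := (⟨(fun q => g q, a, b), hab, hinj⟩, i, decide (i ∈ A), n)
    have hp : y p ∈ Ioo a b := (hy p).1
    refine ⟨y p, hp, ?_, ?_⟩
    · rw [hχ A p _ (Or.inl rfl), if_pos (by simp [p])]
    · rw [hχ B p _ (Or.inr (ratSup_eq hg himage hp).symm), if_neg]
      simp only [p, decide_eq_true_eq]
      tauto
  · have h1 : ∃ m : ℕ, (n : ℝ) + 2 = m + 2 := ⟨n, rfl⟩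
    have h2 : χ A (n + 2) = h1.choose := dif_pos h1
    rw [h2]
    have h3 := h1.choose_spec
    exact_mod_cast (add_right_cancel h3).symm

end Colouring

/-! ### The tree `T`: well-stratification and failure of grading. -/

open Ordinal

theorem succ_lt_omega_one {a : Ordinal.{0}} (ha : a < omega 1) : Order.succ a < omega 1 := by
  rw [← Cardinal.ord_aleph] at ha ⊢
  exact (Cardinal.isSuccLimit_ord (Cardinal.aleph0_le_aleph 1)).succ_lt ha

namespace BGLTree

/-- The ordinal on which an element of the tree is defined. -/
noncomputable def dom (r : BGLTree) : Ordinal.{0} := r.2.1.choose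

theorem dom_lt (r : BGLTree) : r.dom < omega 1 := r.2.1.choose_spec.1

theorem dom_iff (r : BGLTree) (b : Ordinal.{0}) : (r.1 b).Dom ↔ b < r.dom :=
  r.2.1.choose_spec.2 b

open Classical in
/-- The value of an element of the tree at an ordinal, `0` outside its domain. -/
noncomputable def val (r : BGLTree) (b : Ordinal.{0}) : ℕ := (r.1 b).getOrElse 0

theorem mem_iff (r : BGLTree) (b : Ordinal.{0}) (n : ℕ) : n ∈ r.1 b ↔ b < r.dom ∧ r.val b = n := by
  classical
  rw [← dom_iff, Part.mem_eq]
  constructor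
  · rintro ⟨h, rfl⟩
    exact ⟨h, Part.getOrElse_of_dom _ h _⟩
  · rintro ⟨h, rfl⟩
    exact ⟨h, (Part.getOrElse_of_dom _ h _).symm⟩

theorem le_iff_val {r s : BGLTree} : r ≤ s ↔ r.dom ≤ s.dom ∧ ∀ b < r.dom, r.val b = s.val b := by
  simp only [BGLTree.le_iff, mem_iff]
  constructor
  · intro h
    refine ⟨le_of_forall_lt fun b hb => (h b _ ⟨hb, rfl⟩).1, fun b hb => ?_⟩
    exact (h b _ ⟨hb, rfl⟩).2.symm
  · rintro ⟨h1, h2⟩ b n ⟨hb, rfl⟩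
    exact ⟨hb.trans_le h1, (h2 b hb).symm⟩

theorem val_inj (r : BGLTree) {b c : Ordinal.{0}} (hb : Order.succ b < r.dom)
    (hc : Order.succ c < r.dom) (h : r.val (Order.succ b) = r.val (Order.succ c)) : b = c :=
  Order.succ_injective (r.2.2.1 _ ⟨b, rfl⟩ _ ⟨c, rfl⟩ _ ((mem_iff _ _ _).2 ⟨hb, rfl⟩)
    ((mem_iff _ _ _).2 ⟨hc, h.symm⟩))

theorem val_succ_ne_zero (r : BGLTree) {b : Ordinal.{0}} (hb : Order.succ b < r.dom) :
    r.val (Order.succ b) ≠ 0 :=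
  r.2.2.2.1 _ ⟨b, rfl⟩ _ ((mem_iff _ _ _).2 ⟨hb, rfl⟩)

theorem val_eq_zero (r : BGLTree) {b : Ordinal.{0}} (hb : b < r.dom)
    (h : b ∉ range (Order.succ : Ordinal.{0} → Ordinal.{0})) : r.val b = 0 :=
  r.2.2.2.2 _ h _ ((mem_iff _ _ _).2 ⟨hb, rfl⟩)

theorem exists_dom_val (a : Ordinal.{0}) (ha : a < omega 1) (v : Ordinal.{0} → ℕ)
    (hinj : ∀ b c, Order.succ b < a → Order.succ c < a → v (Order.succ b) = v (Order.succ c) → b = c)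
    (hne : ∀ b, Order.succ b < a → v (Order.succ b) ≠ 0)
    (hzero : ∀ b < a, b ∉ range (Order.succ : Ordinal.{0} → Ordinal.{0}) → v b = 0) :
    ∃ r : BGLTree, r.dom = a ∧ ∀ b < a, r.val b = v b := by
  let r : BGLTree := ⟨fun b => ⟨b < a, fun _ => v b⟩, ⟨a, ha, fun _ => Iff.rfl⟩, by
    rintro _ ⟨b, rfl⟩ _ ⟨c, rfl⟩ n ⟨hb, rfl⟩ ⟨hc, h⟩
    exact congrArg _ (hinj b c hb hc h.symm), by
    rintro _ ⟨b, rfl⟩ n ⟨hb, rfl⟩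
    exact hne b hb, by
    rintro b h n ⟨hb, rfl⟩
    exact hzero b hb h⟩
  refine ⟨r, eq_of_forall_lt_iff fun b => (r.dom_iff b).symm, fun b hb => ?_⟩
  exact ((r.mem_iff b (v b)).1 ⟨hb, rfl⟩).2

theorem le_total_of_le {r s t : BGLTree} (hs : s ≤ r) (ht : t ≤ r) : s ≤ t ∨ t ≤ s := by
  rw [le_iff_val] at hs ht
  rcases le_total s.dom t.dom with h | h
  · exact Or.inl (le_iff_val.2 ⟨h, fun b hb => by rw [hs.2 b hb, ht.2 b (hb.trans_le h)]⟩)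
  · exact Or.inr (le_iff_val.2 ⟨h, fun b hb => by rw [ht.2 b hb, hs.2 b (hb.trans_le h)]⟩)

theorem dom_strictMono : StrictMono dom := fun r s h => by
  have hle := le_iff_val.1 h.le
  refine hle.1.lt_of_ne fun heq => h.not_ge (le_iff_val.2 ⟨heq.ge, fun b hb => ?_⟩)
  exact (hle.2 b (heq ▸ hb)).symm

instance : IsTreeOrder BGLTree where
  isChain_Iic _ _ hs _ ht _ := le_total_of_le hs ht
  exists_root := by
    obtain ⟨r, hr, -⟩ := exists_dom_val 0 (omega_pos 1) 0 (by simp) (by simp) (by simp)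
    exact ⟨r, fun x => le_iff_val.2 ⟨by simp [hr], by simp [hr]⟩⟩

instance : IsWellStratified BGLTree where
  branch_iso B hB := by
    let _ : LinearOrder B :=
      { (inferInstance : PartialOrder B) with
        le_total := fun a b => hB.1.total a.2 b.2
        toDecidableLE := Classical.decRel _ }
    have hmono : StrictMono fun r : B => r.1.dom := fun r s h => dom_strictMono h
    have : WellFoundedLT B := hmono.wellFoundedLT
    obtain ⟨e⟩ := Ordinal.type_eq.1 (type_toType (typeLT B))
    exact ⟨typeLT B, ⟨(OrderIso.ofRelIsoLT e).symm.trans ToType.mk.symm⟩⟩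

/-- The nonzero natural numbers which are not values of `r`. -/
def free (r : BGLTree) : Set ℕ := {n | n ≠ 0 ∧ ∀ b < r.dom, r.val b ≠ n}

/-- A one-step extension uses up at most one free value, which can be taken outside `N`. -/
theorem exists_gt {r : BGLTree} {N : Finset ℕ} (hN : ↑N ⊆ r.free) (hr : r.free.Infinite) :
    ∃ s, r < s ∧ ↑N ⊆ s.free ∧ s.free.Infinite := by
  classical
  obtain ⟨m, ⟨hm0, hm⟩, hmN⟩ := hr.exists_notMem_finset N
  let v : Ordinal.{0} → ℕ := fun b =>
    if b < r.dom then r.val b else if b ∈ range (Order.succ : Ordinal.{0} → Ordinal.{0}) then m else 0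
  have hv : ∀ b < r.dom, v b = r.val b := fun b hb => if_pos hb
  have hv' : ∀ b, ¬ Order.succ b < r.dom → v (Order.succ b) = m := fun b hb => by
    simp only [v, if_neg hb, mem_range_self, if_true]
  have hlt : ∀ {b}, b < Order.succ r.dom → ¬ b < r.dom → b = r.dom := fun h1 h2 =>
    le_antisymm (Order.le_of_lt_succ h1) (not_lt.1 h2)
  obtain ⟨s, hs, hsv⟩ := exists_dom_val (Order.succ r.dom)
    (succ_lt_omega_one r.dom_lt) v (fun b c hb hc h => by
      by_cases hb' : Order.succ b < r.dom <;> by_cases hc' : Order.succ c < r.dom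
      · rw [hv _ hb', hv _ hc'] at h
        exact r.val_inj hb' hc' h
      · rw [hv _ hb', hv' _ hc'] at h
        exact absurd h (hm _ hb')
      · rw [hv' _ hb', hv _ hc'] at h
        exact absurd h.symm (hm _ hc')
      · exact Order.succ_injective ((hlt hb hb').trans (hlt hc hc').symm))
    (fun b hb => by
      by_cases hb' : Order.succ b < r.dom
      · rw [hv _ hb']; exact r.val_succ_ne_zero hb'
      · rw [hv' _ hb']; exact hm0)
    (fun b hb h => by
      by_cases hb' : b < r.dom
      · rw [hv _ hb']; exact r.val_eq_zero hb' h
      · simp only [v, if_neg hb', if_neg h])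
  have hfree : ∀ n ∈ r.free, n ≠ m → n ∈ s.free := fun n hn hnm => by
    refine ⟨hn.1, fun b hb => ?_⟩
    rw [hs] at hb
    rw [hsv b hb]
    by_cases hb' : b < r.dom
    · rw [hv b hb']; exact hn.2 b hb'
    · simp only [v, if_neg hb']
      split_ifs
      · exact hnm.symm
      · exact hn.1.symm
  refine ⟨s, lt_of_le_of_ne (le_iff_val.2 ⟨hs ▸ Order.le_succ _, fun b hb => ?_⟩) ?_,
    fun n hn => hfree n (hN hn) fun h => hmN (h ▸ hn),
    (hr.sdiff (finite_singleton m)).mono fun n hn => hfree n hn.1 hn.2⟩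
  · rw [hsv b (hb.trans (Order.lt_succ _)), hv b hb]
  · rintro rfl
    exact (Order.lt_succ r.dom).ne hs

/-- A condition `(r, N)` promises that the values in `N` stay unused. Each step reserves one more
value and then comes within `1 / (k + 1)` of the supremum of the grading over admissible extensions.
The reserved values leave infinitely many free at the limit, so an extension past the limit is still
admissible at every stage. -/
theorem not_isRealGradable : ¬ IsRealGradable BGLTree := by
  rintro ⟨l₀, hl₀⟩
  -- Composing with `arctan` bounds the grading, so the suprema exist.
  obtain ⟨l, hl, hbdd⟩ : ∃ l : BGLTree → ℝ, StrictMono l ∧ ∀ r, l r ≤ Real.pi / 2 :=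
    ⟨fun r => Real.arctan (l₀ r), Real.arctan_strictMono.comp hl₀,
      fun r => (Real.arctan_lt_pi_div_two _).le⟩
  let S := {p : BGLTree × Finset ℕ // ↑p.2 ⊆ p.1.free ∧ p.1.free.Infinite}
  have hstep : ∀ (k : ℕ) (p : S), ∃ q : S, p.1.1 < q.1.1 ∧ p.1.2 ⊂ q.1.2 ∧
      ∀ t, p.1.1 < t → ↑q.1.2 ⊆ t.free → t.free.Infinite → l t < l q.1.1 + 1 / (k + 1) := by
    classical
    rintro k ⟨⟨r, N⟩, hN, hr⟩
    obtain ⟨n, hn, hnN⟩ := hr.exists_notMem_finset N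
    have hN' : ↑(insert n N) ⊆ r.free := by
      rw [Finset.coe_insert]
      exact insert_subset hn hN
    let E : Set ℝ := l '' {t | r < t ∧ ↑(insert n N) ⊆ t.free ∧ t.free.Infinite}
    have hE : E.Nonempty := (exists_gt hN' hr).elim fun s hs => ⟨_, s, hs, rfl⟩
    have hEb : BddAbove E := ⟨Real.pi / 2, by rintro _ ⟨t, -, rfl⟩; exact hbdd t⟩
    have hk : (0 : ℝ) < 1 / (k + 1) := Nat.one_div_pos_of_nat
    obtain ⟨_, ⟨s, ⟨h1, h2, h3⟩, rfl⟩, hs⟩ := exists_lt_of_lt_csSup hE (sub_lt_self (sSup E) hk)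
    refine ⟨⟨⟨s, insert n N⟩, h2, h3⟩, h1, Finset.ssubset_insert hnN, fun t k1 k2 k3 => ?_⟩
    have := le_csSup hEb ⟨t, ⟨k1, k2, k3⟩, rfl⟩
    exact this.trans_lt (sub_lt_iff_lt_add.1 hs)
  choose next hnext using hstep
  obtain ⟨r₀, hr₀, -⟩ := exists_dom_val 0 (omega_pos 1) 0 (by simp) (by simp) (by simp)
  have hfree₀ : r₀.free.Infinite := by
    have : r₀.free = {0}ᶜ := by
      ext n
      simp [free, hr₀]
    rw [this]
    exact (finite_singleton 0).infinite_compl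
  let s : ℕ → S := Nat.rec ⟨⟨r₀, ∅⟩, by simp, hfree₀⟩ next
  let r : ℕ → BGLTree := fun k => (s k).1.1
  let N : ℕ → Finset ℕ := fun k => (s k).1.2
  have hr : StrictMono r := strictMono_nat_of_lt_succ fun k => (hnext k (s k)).1
  have hN : StrictMono N := strictMono_nat_of_lt_succ fun k => (hnext k (s k)).2.1
  have hmax : ∀ k t, r k < t → ↑(N (k + 1)) ⊆ t.free → t.free.Infinite →
      l t < l (r (k + 1)) + 1 / (k + 1) := fun k => (hnext k (s k)).2.2
  have hNr : ∀ k, ↑(N k) ⊆ (r k).free := fun k => (s k).2.1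
  have hval : ∀ j k b, b < (r j).dom → b < (r k).dom → (r j).val b = (r k).val b :=
    fun j k b hj hk => by
      rcases le_total j k with h | h
      · exact (le_iff_val.1 (hr.monotone h)).2 b hj
      · exact ((le_iff_val.1 (hr.monotone h)).2 b hk).symm
  have hv : ∀ b, ∃ n : ℕ, (∀ k, b < (r k).dom → n = (r k).val b) ∧
      ((∀ k, ¬ b < (r k).dom) → n = 0) := fun b => by
    by_cases h : ∃ k, b < (r k).dom
    · obtain ⟨j, hj⟩ := h
      exact ⟨(r j).val b, fun k hk => hval j k b hj hk, fun h => absurd hj (h j)⟩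
    · push Not at h
      exact ⟨0, fun k hk => absurd hk (h k).not_gt, fun _ => rfl⟩
  choose v hv hv0 using hv
  let a : Ordinal.{0} := ⨆ k, (r k).dom
  have ha : a < omega 1 := iSup_lt_omega_one fun k => (r k).dom_lt
  have hra : ∀ k, (r k).dom < a := fun k =>
    (dom_strictMono (hr k.lt_succ_self)).trans_le (Ordinal.le_iSup (fun k => (r k).dom) (k + 1))
  have hex : ∀ b < a, ∃ k, b < (r k).dom := fun b hb => Ordinal.lt_iSup_iff.1 hb
  -- The index `a` is a limit, so extending across it takes the value `0` and consumes no reserved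
  -- number.
  have hva : v a = 0 := hv0 a fun k => (hra k).not_gt
  have hsucc : ∀ b, Order.succ b < Order.succ a → ∃ k, Order.succ b < (r k).dom := fun b hb => by
    obtain ⟨k, hk⟩ := hex b (Order.succ_lt_succ_iff.1 hb)
    exact ⟨k + 1, (Order.succ_le_of_lt hk).trans_lt (dom_strictMono (hr k.lt_succ_self))⟩
  have hinj : ∀ b c, Order.succ b < Order.succ a → Order.succ c < Order.succ a →
      v (Order.succ b) = v (Order.succ c) → b = c := fun b c hb hc h => by
    obtain ⟨j, hj⟩ := hsucc b hb
    obtain ⟨k, hk⟩ := hsucc c hc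
    have hj' := hj.trans_le (dom_strictMono.monotone (hr.monotone (le_max_left j k)))
    have hk' := hk.trans_le (dom_strictMono.monotone (hr.monotone (le_max_right j k)))
    rw [hv _ _ hj', hv _ _ hk'] at h
    exact (r (max j k)).val_inj hj' hk' h
  have hne : ∀ b, Order.succ b < Order.succ a → v (Order.succ b) ≠ 0 := fun b hb => by
    obtain ⟨j, hj⟩ := hsucc b hb
    rw [hv _ _ hj]
    exact (r j).val_succ_ne_zero hj
  have hzero : ∀ b < Order.succ a, b ∉ range (Order.succ : Ordinal.{0} → Ordinal.{0}) → v b = 0 :=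
    fun b hb h => by
      rcases (Order.le_of_lt_succ hb).lt_or_eq with hb | rfl
      · obtain ⟨k, hk⟩ := hex b hb
        rw [hv b k hk]
        exact (r k).val_eq_zero hk h
      · exact hva
  have has : a < Order.succ a := Order.lt_succ a
  obtain ⟨u, hu, huv⟩ := exists_dom_val a ha v
    (fun b c hb hc => hinj b c (hb.trans has) (hc.trans has)) (fun b hb => hne b (hb.trans has))
    (fun b hb => hzero b (hb.trans has))
  obtain ⟨t, ht, htv⟩ := exists_dom_val (Order.succ a) (succ_lt_omega_one ha) v
    hinj hne hzero
  have hut : u < t := lt_of_le_of_ne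
    (le_iff_val.2 ⟨by rw [hu, ht]; exact has.le, fun b hb => by
      rw [hu] at hb
      rw [huv b hb, htv b (hb.trans has)]⟩) (by
      rintro rfl
      exact has.ne (hu.symm.trans ht))
  have hru : ∀ k, r k ≤ u := fun k => le_iff_val.2 ⟨by rw [hu]; exact (hra k).le, fun b hb => by
    rw [huv b (hb.trans (hra k)), hv b k hb]⟩
  have hfree : ∀ k, ↑(N k) ⊆ t.free := fun k n hn => by
    refine ⟨(hNr k hn).1, fun b hb => ?_⟩
    rw [ht] at hb
    rw [htv b hb]
    rcases (Order.le_of_lt_succ hb).lt_or_eq with hb | rfl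
    · obtain ⟨j, hj⟩ := hex b hb
      have hj' := hj.trans_le (dom_strictMono.monotone (hr.monotone (le_max_left j k)))
      rw [hv b _ hj']
      exact (hNr _ (hN.monotone (le_max_right j k) hn)).2 b hj'
    · rw [hva]
      exact (hNr k hn).1.symm
  have hinf : t.free.Infinite := by
    intro hfin
    have hcard : StrictMono fun k => (N k).card := fun j k h => Finset.card_lt_card (hN h)
    have h1 := hcard.le_apply (x := hfin.toFinset.card + 1)
    have h2 : N (hfin.toFinset.card + 1) ⊆ hfin.toFinset := fun n hn =>
      hfin.mem_toFinset.2 (hfree (hfin.toFinset.card + 1) hn)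
    have h3 := Finset.card_le_card h2
    omega
  -- For every `k`, `l t` is less than `l (r (k + 1)) + 1 / (k + 1)`, hence than `l u + 1 / (k +
  -- 1)`, contradicting `l u < l t`.
  have hlt := hl hut
  obtain ⟨k, hk⟩ := exists_nat_one_div_lt (sub_pos.2 hlt)
  have h1 := hmax k t ((hru k).trans_lt hut) (hfree (k + 1)) hinf
  have h2 := hl.monotone (hru (k + 1))
  linarith

end BGLTree

/-! ### Embedding `T` into the ray tree. -/

theorem exists_orderEmbedding_rayNode {W : Type} [LinearOrder W] [SuccOrder W] [NoMaxOrder W]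
    {K : Type u} [Zero K] [Nontrivial K] {col : W × (W → ℝ × K) → ℝ → ℕ}
    (φ : W ≃o Iio (omega 1 : Ordinal.{0})) (hcol : ∀ R (n : ℕ), col R (n + 2) = n) :
    Nonempty (BGLTree ↪o RayNode col) := by
  obtain ⟨k, hk⟩ := exists_ne (0 : K)
  let o : W → Ordinal.{0} := fun β => (φ β).1
  have ho : StrictMono o := fun _ _ h => φ.strictMono h
  have hosurj : ∀ b < (omega 1 : Ordinal.{0}), ∃ β, o β = b := fun b hb =>
    ⟨φ.symm ⟨b, hb⟩, by simp [o]⟩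
  have hosucc : ∀ β, o (Order.succ β) ≤ Order.succ (o β) := fun β => by
    obtain ⟨γ, hγ⟩ := hosurj _ (succ_lt_omega_one (φ β).2)
    have : β < γ := ho.lt_iff_lt.1 (by rw [hγ]; exact Order.lt_succ _)
    exact hγ ▸ ho.monotone (Order.succ_le_of_lt this)
  -- Domain `c + 1` yields the ray index `c`; a zero or limit domain yields itself. In both cases
  -- the exits below `len r` encode exactly the successor values of `r`.
  have hlen : ∀ r : BGLTree, ∃ δ : W, r.dom ≤ Order.succ (o δ) ∧ o δ ≤ r.dom ∧
      ∀ b, r.dom ≤ Order.succ b → o δ ≤ b := fun r => by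
    let b := sInf {b | r.dom ≤ Order.succ b}
    have hmem : r.dom ∈ {b | r.dom ≤ Order.succ b} := Order.le_succ r.dom
    have hb : r.dom ≤ Order.succ b := csInf_mem ⟨_, hmem⟩
    have hle : ∀ c, r.dom ≤ Order.succ c → b ≤ c := fun c hc => csInf_le' hc
    obtain ⟨δ, hδ⟩ := hosurj b ((hle _ hmem).trans_lt r.dom_lt)
    exact ⟨δ, hδ ▸ hb, hδ ▸ hle _ hmem, hδ ▸ hle⟩
  choose len hlen1 hlen2 hlen3 using hlen
  have hlt : ∀ {r : BGLTree} {β}, β < len r → Order.succ (o β) < r.dom := fun {r β} hβ => by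
    by_contra! h
    exact (ho hβ).not_ge (hlen3 r _ h)
  let e : BGLTree → W → ℝ × K := fun r β => ((r.val (Order.succ (o β)) : ℝ) + 2, k)
  -- Coordinates `0` and `1` distinguish a zero or limit domain `c` from the domain `c + 1`, which
  -- share a ray. All exits are at coordinates at least `1`, so longer functions pass both points.
  let t : BGLTree → ℝ := fun r => if r.dom ≤ o (len r) then 0 else 1
  have ht0 : ∀ r, 0 ≤ t r := fun r => by simp only [t]; split_ifs <;> norm_num
  have ht1 : ∀ r, t r ≤ 1 := fun r => by simp only [t]; split_ifs <;> norm_num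
  have he0 : ∀ r β, (1 : ℝ) ≤ (e r β).1 := fun r β => by
    have : (0 : ℝ) ≤ r.val (Order.succ (o β)) := Nat.cast_nonneg _
    simp only [e]; linarith
  let Φ : BGLTree → RayNode col := fun r => RayNode.glue (e r) (len r) (t r) (fun _ _ => hk)
    (fun β _ => zero_le_one.trans (he0 r β)) (ht0 r)
    (fun β _ _ => zero_lt_one.trans_le (he0 r _))
    (fun β hβ hs => by
      have h : ¬ r.dom ≤ o (len r) := fun h =>
        (ho hβ).not_ge (hlen3 r _ (h.trans (hs ▸ hosucc β)))
      simp [t, h])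
    (fun n => Set.Subsingleton.finite fun β hβ γ hγ => by
      have h : r.val (Order.succ (o β)) = r.val (Order.succ (o γ)) := by
        have h1 := hβ.2
        have h2 := hγ.2
        simp only [pathLabel, e, hcol] at h1 h2
        rw [h1, h2]
      exact ho.injective (r.val_inj (hlt hβ.1) (hlt hγ.1) h))
  refine ⟨OrderEmbedding.ofMapLEIff Φ fun r s => ⟨fun h => ?_, fun h => ?_⟩⟩
  · have hl : len r ≤ len s := RayNode.len_le h
    have hdom : r.dom ≤ s.dom := by
      by_contra! hlt'
      have hls : o (len s) = o (len r) :=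
        le_antisymm (hlen3 s _ (hlt'.le.trans (hlen1 r))) (ho.monotone hl)
      have hs : s.dom ≤ o (len s) := Order.le_of_lt_succ (hlt'.trans_le (hls ▸ hlen1 r))
      have hr : ¬ r.dom ≤ o (len r) := fun hr =>
        (hlt'.trans_le (hr.trans_eq hls.symm)).not_ge (hlen2 s)
      have hp := RayNode.pos_le_pos h (ho.injective hls.symm)
      rw [show (Φ r).pos = t r from RayNode.glue_pos, show (Φ s).pos = t s from RayNode.glue_pos]
        at hp
      simp only [t, if_pos hs, if_neg hr] at hp
      linarith
    refine BGLTree.le_iff_val.2 ⟨hdom, fun b hb => ?_⟩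
    by_cases hbs : b ∈ range (Order.succ : Ordinal.{0} → Ordinal.{0})
    · obtain ⟨c, rfl⟩ := hbs
      obtain ⟨β, rfl⟩ := hosurj c ((Order.lt_succ c).trans (hb.trans r.dom_lt))
      have hβ : β < len r := by
        by_contra! hβ
        exact (hb.trans_le (hlen1 r)).not_ge (Order.succ_le_succ (ho.monotone hβ))
      have hpath := RayNode.path_eq h (β := β) hβ
      rw [show (Φ r).path β = e r β from RayNode.glue_path hβ,
        show (Φ s).path β = e s β from RayNode.glue_path (hβ.trans_le hl)] at hpath
      exact_mod_cast add_right_cancel (congrArg Prod.fst hpath)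
    · rw [r.val_eq_zero hb hbs, s.val_eq_zero (hb.trans_le hdom) hbs]
  · obtain ⟨hdom, hval⟩ := BGLTree.le_iff_val.1 h
    have hl : len r ≤ len s := ho.le_iff_le.1 (hlen3 r _ (hdom.trans (hlen1 s)))
    refine ⟨hl, fun β hβ => ?_, ?_⟩
    · replace hβ : β < len r := hβ
      rw [show (Φ r).path β = e r β from RayNode.glue_path hβ,
        show (Φ s).path β = e s β from RayNode.glue_path (hβ.trans_le hl)]
      simp only [e, hval _ (hlt hβ)]
    · rw [show (Φ r).pos = t r from RayNode.glue_pos]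
      change t r ≤ ((Φ s).path (len r)).1
      rcases hl.lt_or_eq with hl' | hl'
      · rw [show (Φ s).path (len r) = e s (len r) from RayNode.glue_path hl']
        exact (ht1 r).trans (he0 s _)
      · rw [hl']
        change t r ≤ (Φ s).pos
        rw [show (Φ s).pos = t s from RayNode.glue_pos]
        by_cases hs : s.dom ≤ o (len s)
        · have hr : r.dom ≤ o (len r) := hl' ▸ hdom.trans hs
          simp [t, hs, hr]
        · simp only [t, if_neg hs]
          exact ht1 r

-- There are at most `𝔠 * (𝔠 * 𝔠⁺) ^ 𝔠 ≤ 2 ^ 𝔠` rays, using `𝔠⁺ ≤ 2 ^ 𝔠`; this is where the bound on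
-- `κ` enters.
open Cardinal in
theorem nonempty_embedding_set_real {W : Type} (hW : #W ≤ 𝔠) {K : Type u}
    (hK : #K ≤ Order.succ 𝔠) : Nonempty (W × (W → ℝ × K) ↪ Set ℝ) := by
  have hK' : #K ≤ 2 ^ (𝔠 : Cardinal.{u}) := hK.trans (Order.succ_le_of_lt (cantor _))
  have hc : (𝔠 : Cardinal.{u}) ≤ 2 ^ (𝔠 : Cardinal.{u}) := (cantor _).le
  have hc0 : ℵ₀ ≤ (2 : Cardinal.{u}) ^ (𝔠 : Cardinal.{u}) := aleph0_le_continuum.trans hc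
  have hmul : (2 : Cardinal.{u}) ^ (𝔠 : Cardinal.{u}) * 2 ^ (𝔠 : Cardinal.{u}) = 2 ^ (𝔠 : Cardinal.{u}) :=
    mul_eq_self hc0
  have hWl : lift.{u} #W ≤ (𝔠 : Cardinal.{u}) := lift_le_continuum.2 hW
  rw [← lift_mk_le']
  have h1 : lift.{0} #(W × (W → ℝ × K)) = lift.{u} #W * (𝔠 * #K) ^ lift.{u} #W := by
    simp [mk_real]
  have h2 : lift.{u} #(Set ℝ) = 2 ^ (𝔠 : Cardinal.{u}) := by simp [mk_real]
  rw [h1, h2]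
  calc lift.{u} #W * (𝔠 * #K) ^ lift.{u} #W
      ≤ 2 ^ (𝔠 : Cardinal.{u}) * (2 ^ (𝔠 : Cardinal.{u}) * 2 ^ (𝔠 : Cardinal.{u})) ^ (𝔠 : Cardinal.{u}) :=
        mul_le_mul' (hWl.trans hc) ((power_le_power_right (mul_le_mul' hc hK')).trans
          (power_le_power_left (mul_ne_zero (power_ne_zero _ two_ne_zero) (power_ne_zero _ two_ne_zero)) hWl))
    _ = 2 ^ (𝔠 : Cardinal.{u}) := by rw [hmul, ← power_mul, continuum_mul_self, hmul]

/-! ### Assembly with `W` of order type ω₁ and `K` of cardinality `κ`. -/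

theorem mainTheorem1 :
    (IsWellStratified BGLTree ∧ ¬ IsRealGradable BGLTree) ∧
    ∀ κ : Cardinal.{u}, 2 ≤ κ → κ ≤ Order.succ Cardinal.continuum.{u} →
      ∃ (X : Type u) (_ : PartialOrder X) (_ : IsBranchwiseReal X),
        IsUniformlyBranching κ X ∧
        IsOrderRigid X ∧
        ¬ IsContinuouslyGradable X ∧
        ¬ IsRealGradable X ∧
        Nonempty (BGLTree ↪o X) := by
  refine ⟨⟨inferInstance, BGLTree.not_isRealGradable⟩, fun κ hκ hκ' => ?_⟩
  let W : Type := (omega 1 : Ordinal.{0}).ToType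
  let φ : W ≃o Iio (omega 1 : Ordinal.{0}) := ToType.mk.symm
  have hcard : Cardinal.mk W = Cardinal.aleph 1 := by simp [W]
  have : Nonempty W := ⟨φ.symm ⟨0, omega_pos 1⟩⟩
  let _ : OrderBot W := WellFoundedLT.toOrderBot W
  have : NoMaxOrder W := ⟨fun w => ⟨φ.symm ⟨_, succ_lt_omega_one (φ w).2⟩, by
    rw [φ.lt_symm_apply]
    exact Order.lt_succ (φ w).1⟩⟩
  have : Uncountable W := by
    rw [← Cardinal.aleph0_lt_mk_iff, hcard]
    exact Cardinal.aleph0_lt_aleph_one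
  have hIio : ∀ w : W, (Iio w).Countable := fun w => by
    rw [← Cardinal.le_aleph0_iff_set_countable, ← Order.lt_succ_iff, Cardinal.succ_aleph0, ← hcard]
    refine Cardinal.mk_Iio_lt w ?_
    rw [hcard, Cardinal.ord_aleph, type_toType]
  have hK : Nontrivial κ.out := by
    rw [← Cardinal.one_lt_iff_nontrivial, Cardinal.mk_out]
    exact Cardinal.one_lt_two.trans_le hκ
  let _ : Zero κ.out := ⟨Classical.arbitrary _⟩
  obtain ⟨A⟩ := nonempty_embedding_set_real (W := W) (K := κ.out)
    (hcard ▸ Cardinal.aleph_one_le_continuum) (by rwa [Cardinal.mk_out])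
  obtain ⟨χ, hχ, hχn⟩ := exists_isMutuallyGeneric
  let col : W × (W → ℝ × κ.out) → ℝ → ℕ := fun R => χ (A R)
  have hgen : IsMutuallyGeneric col := fun R R' hne => hχ _ _ (A.injective.ne hne)
  obtain ⟨ι⟩ := exists_orderEmbedding_rayNode (col := col) φ fun R n => hχn _ n
  have hgrad : ¬ IsRealGradable (RayNode col) := fun ⟨l, hl⟩ =>
    BGLTree.not_isRealGradable ⟨fun r => l (ι r), hl.comp ι.strictMono⟩
  exact ⟨RayNode col, inferInstance, inferInstance,
    fun x => (RayNode.treeDegree_eq x).trans κ.mk_out, RayNode.isOrderRigid hIio hgen,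
    fun ⟨l, hl⟩ => hgrad ⟨l, hl.1⟩, hgrad, ⟨ι⟩⟩
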